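/- An index is a finite tuple of positive integers $\boldsymbol{k}=(k_1,\dots,k_r)$; $r$ is its depth, $\mathrm{wt}(\boldsymbol{k})=k_1+\cdots+k_r$ its weight, and it is admissible if $r=0$ or $k_r\ge 2$. For an admissible index $\boldsymbol{k}$ of depth $r$ and real $z_1,\dots,z_r$ with $|z_i|\le 1$, put \[ \mathrm{Li}^{\mathrm{sh}}_{\boldsymbol{k}}(z_1,\dots,z_r)=\sum_{0=m_0<m_1<\cdots<m_r}\ \prod_{i=1}^r\frac{z_i^{m_i-m_{i-1}}}{m_i^{k_i}} . \] For indices $\boldsymbol{k}_j=(k^{(j)}_1,\dots,k^{(j)}_{r_j})$ $(1\le j\le n)$ and $\boldsymbol{l}=(l_1,\dots,l_s)$, the multiple connected sum is \[ Z_n(\boldsymbol{k}_1;\dots;\boldsymbol{k}_n\mid\boldsymbol{l})=\sum \frac{m^{(1)}_{r_1}!\cdots m^{(n)}_{r_n}!}{(m^{(1)}_{r_1}+\cdots+m^{(n)}_{r_n})!}\cdot\prod_{j=1}^n\prod_{i=1}^{r_j}\frac1{(m^{(j)}_i)^{k^{(j)}_i}}\cdot q_s\prod_{i=1}^s\frac1{q_i^{l_i}},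 \] where the sum runs over all integers $0=m^{(j)}_0<m^{(j)}_1<\cdots<m^{(j)}_{r_j}$ $(1\le j\le n)$ and $0=q_0<q_1\le\cdots\le q_s=m^{(1)}_{r_1}+\cdots+m^{(n)}_{r_n}$. Theorem 1.1. Let $n\ge 2$, let $\boldsymbol{k}_1,\dots,\boldsymbol{k}_n,\boldsymbol{l}$ be non-empty indices, and let $k=\mathrm{wt}(\boldsymbol{k}_1)+\cdots+\mathrm{wt}(\boldsymbol{k}_n)+\mathrm{wt}(\boldsymbol{l})$. Let \[ \mathrm{MPL}(n,k)=\Bigl\{\mathrm{Li}^{\mathrm{sh}}_{\boldsymbol{k}}(1,z_2,\dots,z_r)\ \Big|\ 1\le r\le k-2,\ \boldsymbol{k}\text{ an admissible index of depth } r \text{ and weight } k-1,\ z_2,\dots,z_r\in\{1,\tfrac12,\dots,\tfrac1n\}\Bigr\}. \] Then the series $Z_n(\boldsymbol{k}_1;\dots;\boldsymbol{k}_n\mid\boldsymbol{l})$ converges absolutely, as do the series of the elements of $\mathrm{MPL}(n,k)$ used in the combination below, and $Z_n(\boldsymbol{k}_1;\dots;\boldsymbol{k}_n\mid\boldsymbol{l})$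 can be written explicitly as a $\mathbb{Z}$-linear combination of elements of $\mathrm{MPL}(n,k)$. Here "explicitly" means: there is a single algorithm which, for every such $n$ and every input $\boldsymbol{k}_1,\dots,\boldsymbol{k}_n,\boldsymbol{l}$, outputs a finite list of integers $c$, admissible indices $\boldsymbol{k}$ and arguments $(1,z_2,\dots,z_r)$ as in the definition of $\mathrm{MPL}(n,k)$ such that $Z_n(\boldsymbol{k}_1;\dots;\boldsymbol{k}_n\mid\boldsymbol{l})=\sum c\,\mathrm{Li}^{\mathrm{sh}}_{\boldsymbol{k}}(1,z_2,\dots,z_r)$. -/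

import Mathlib

/-- A tuple of positive integers; `r` is its depth. -/
def IsIndex {r : ℕ} (k : Fin r → ℕ) : Prop := ∀ i, 0 < k i

/-- The last entry, if there is one, is at least `2`; the empty index is admissible. -/
def IsAdmissible {r : ℕ} (k : Fin r → ℕ) : Prop := ∀ i : Fin r, (i : ℕ) + 1 = r → 2 ≤ k i

/-- The weight of an index. -/
def weight {r : ℕ} (k : Fin r → ℕ) : ℕ := ∑ i, k i

/-- Tuples `0 = m₀ < m₁ < ⋯ < m_r`. -/
def StrictChain (r : ℕ) : Type := {m : Fin (r + 1) → ℕ // m 0 = 0 ∧ StrictMono m}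

/-- Tuples `0 = q₀ < q₁ ≤ ⋯ ≤ q_s = N`. -/
def StarChain (s N : ℕ) : Type :=
  {q : Fin (s + 1) → ℕ // q 0 = 0 ∧ (∀ i : Fin s, 0 < q i.succ) ∧ Monotone q ∧ q (Fin.last s) = N}

/-- The connector `a₁! ⋯ aₙ! / (a₁ + ⋯ + aₙ)!`. -/
noncomputable def connector {n : ℕ} (a : Fin n → ℕ) : ℝ :=
  (∏ j, ((a j).factorial : ℝ)) / ((∑ j, a j).factorial : ℝ)

/-- The last entry `m_r` of a strict chain. -/
def StrictChain.last {r : ℕ} (m : StrictChain r) : ℕ := m.1 (Fin.last r)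

/-- The range of summation of the multiple connected sum: `m⁽¹⁾, …, m⁽ⁿ⁾` together with `q`,
whose last entry is the sum of the last entries of the `m⁽ʲ⁾`. -/
def ConnectedChain {n : ℕ} (r : Fin n → ℕ) (s : ℕ) : Type :=
  Σ m : (∀ j, StrictChain (r j)), StarChain s (∑ j, (m j).last)

/-- The summand of the multiple connected sum `Z_n(k₁; …; kₙ | l)`. -/
noncomputable def connectedTerm {n : ℕ} {r : Fin n → ℕ} {s : ℕ}
    (k : ∀ j, Fin (r j) → ℕ) (l : Fin s → ℕ) (x : ConnectedChain r s) : ℝ :=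
  connector (fun j => (x.1 j).last)
    * (∏ j, ∏ i : Fin (r j), 1 / ((x.1 j).1 i.succ : ℝ) ^ k j i)
    * ((x.2.1 (Fin.last s) : ℝ) * ∏ i : Fin s, 1 / (x.2.1 i.succ : ℝ) ^ l i)

/-- The multiple connected sum `Z_n(k₁; …; kₙ | l)`. (For empty `l` every summand vanishes, so the
value is `0`.) -/
noncomputable def connectedSum {n : ℕ} {r : Fin n → ℕ} {s : ℕ}
    (k : ∀ j, Fin (r j) → ℕ) (l : Fin s → ℕ) : ℝ :=
  ∑' x : ConnectedChain r s, connectedTerm k l x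

/-- The summand of the shuffle-type multiple polylogarithm. The exponent `m_i - m_{i-1}` is a
difference of natural numbers with `m_{i-1} < m_i`. -/
noncomputable def liTerm {r : ℕ} (k : Fin r → ℕ) (z : Fin r → ℝ) (m : StrictChain r) : ℝ :=
  ∏ i : Fin r, z i ^ (m.1 i.succ - m.1 i.castSucc) / (m.1 i.succ : ℝ) ^ k i

/-- The shuffle-type multiple polylogarithm, for real arguments. -/
noncomputable def liSh {r : ℕ} (k : Fin r → ℕ) (z : Fin r → ℝ) : ℝ :=
  ∑' m : StrictChain r, liTerm k z m

/-- The parameters `(k; 1, z₂, …, z_r)` allowed in `MPL(n, K)`: the depth satisfies `1 ≤ r ≤ K - 2`,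
`k` is an admissible index of weight `K - 1`, `z₁ = 1`, and all `z_i` lie in `{1, 1/2, …, 1/n}`. -/
def IsMPLParam (n K : ℕ) {r : ℕ} (k : Fin r → ℕ) (z : Fin r → ℝ) : Prop :=
  1 ≤ r ∧ r + 2 ≤ K ∧ IsIndex k ∧ IsAdmissible k ∧ weight k + 1 = K ∧
    (∀ i : Fin r, (i : ℕ) = 0 → z i = 1) ∧
    ∀ i : Fin r, ∃ d : ℕ, 1 ≤ d ∧ d ≤ n ∧ z i = 1 / (d : ℝ)

/-- The set `MPL(n, K)` of special values of shuffle-type multiple polylogarithms. -/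
def MPL (n K : ℕ) : Set ℝ :=
  {x | ∃ (r : ℕ) (k : Fin r → ℕ) (z : Fin r → ℝ), IsMPLParam n K k z ∧ x = liSh k z}

/-- A list of pairs `(k₁, d₁), …, (k_r, d_r)` of natural numbers encodes the index
`(k₁, …, k_r)` … -/
def codeIndex (p : List (ℕ × ℕ)) (i : Fin p.length) : ℕ := (p.get i).1

/-- … and the arguments `(1/d₁, …, 1/d_r)`. -/
noncomputable def codeArg (p : List (ℕ × ℕ)) (i : Fin p.length) : ℝ := 1 / ((p.get i).2 : ℝ)

/-! A word in the letters 0, 1, 2, … stands for an iterated integral in the forms `dx/x` (letter 0)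
and `dx/(a-x)` (letter a), and `coef` lists its Taylor coefficients. Grouping each positive letter
`d` with the zeros outside it turns the value at 1 into a shuffle-type polylogarithm with arguments
`1/d` (`blocks_spec`). Word length becomes weight, an outermost 0 becomes admissibility, and an
innermost 1 becomes `z₁ = 1`.

Three identities carry the reduction. `connProd_letterOp`: convolution weighted by `i! j!/(i+j)!`
obeys a product rule in which the outermost letters are added, so it expands words into signed
words. Convolving `n` words with letters at most 1 produces letters up to `n`, hence the arguments
`1/d` with `d ≤ n`. `letterOp_mul_starSum`: a truncated star sum multiplied onto a word expands
again into words. `pairSum_transport`: in a connected sum of two words whose outermost star entry is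
1, a telescoping identity for the connector moves the outermost letter of one word to the other,
exchanging 0 and 1, or else uses up the star entry.

If the outermost star entry is `b ≥ 2`, the first two identities suffice: the remaining factor
`m^(1-b)` puts a 0 in front of every word and all the series converge. If `b = 1`, single words
could diverge. So all indices but the first are convolved into one word `v`, the first is kept as a
word `w` in 0 and 1, and letters are transported from `w` to `v`. This stops when an entry `b ≥ 2`
becomes outermost, when the star index is used up (value 0), or when `w` is empty. In the last case
the innermost 1 of `w` has just arrived as a 0 in front of `v`, which gives convergence.

All original summands are nonnegative, so rearrangements are done in `ENNReal`, and finiteness is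
read off from the terminal states. Every expansion is a bounded iteration of a list-valued step,
which makes the algorithm primitive recursive. -/

/-- A signed computation state: a sign exponent and three lists. -/
abbrev SignedState := ℕ × List ℕ × List ℕ × List ℕ

/-- Apply a nondeterministic rewriting step `n` times. -/
def expand {σ : Type} (step : σ → List σ) : ℕ → σ → List σ
  | 0, t => [t]
  | n + 1, t => (step t).flatMap (expand step n)

/-- `1` for the letter `0`, and `0` for every other letter. -/
def zeroFlag (a : ℕ) : ℕ := if a = 0 then 1 else 0

/-- `n` zeros in front of a list. -/
def prependZeros (n : ℕ) (p : List ℕ) : List ℕ := (List.cons 0)^[n] p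

/-- One step of the expansion of the convolution product of two words; the first list is the
reversed prefix already produced. -/
def convStep (t : SignedState) : List SignedState :=
  if t.2.2.1 = [] then [t] else if t.2.2.2 = [] then [t] else
    [(t.1 + zeroFlag (t.2.2.1.headI + t.2.2.2.headI) + zeroFlag t.2.2.1.headI,
        (t.2.2.1.headI + t.2.2.2.headI) :: t.2.1, t.2.2.1.tail, t.2.2.2),
      (t.1 + zeroFlag (t.2.2.1.headI + t.2.2.2.headI) + zeroFlag t.2.2.2.headI,
        (t.2.2.1.headI + t.2.2.2.headI) :: t.2.1, t.2.2.1, t.2.2.2.tail)]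

/-- One step of the expansion of the product of a word with a star sum. -/
def starStep (t : SignedState) : List SignedState :=
  if t.2.2.2 = [] then [t] else if t.2.2.1 = [] then [] else
    if t.2.2.1.headI = 0 then [(t.1, 0 :: t.2.1, t.2.2.1.tail, t.2.2.2)] else
      [(t.1, t.2.2.1.headI :: t.2.1, t.2.2.1.tail, t.2.2.2),
        (t.1, prependZeros t.2.2.2.headI t.2.1, t.2.2.1, t.2.2.2.tail),
        (t.1, prependZeros (t.2.2.2.headI - 1) (t.2.2.1.headI :: t.2.1), t.2.2.1, t.2.2.2.tail)]

/-- One step of the transport of letters from the second word to the first one; the first list is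
the reversed star index. -/
def transportStep (t : SignedState) : List SignedState :=
  if t.2.1 = [] then [] else if t.2.1.headI = 1 then
    if t.2.2.2 = [] then [t] else if t.2.2.2.headI = 0 then
      [(t.1, t.2.1, 1 :: t.2.2.1, t.2.2.2.tail), (t.1 + 1, t.2.1.tail, 1 :: t.2.2.1, t.2.2.2)]
    else [(t.1, t.2.1, 0 :: t.2.2.1, t.2.2.2.tail), (t.1, t.2.1.tail, 0 :: t.2.2.1, t.2.2.2)]
  else [t]

/-- The signed word that a finished state stands for. -/
def readOff (t : SignedState) : ℕ × List ℕ := (t.1, t.2.1.reverse ++ (t.2.2.1 ++ t.2.2.2))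

/-- The expansion of the convolution product of two words. -/
def convWords (s : ℕ) (x y : List ℕ) : List (ℕ × List ℕ) :=
  (expand convStep (x.length + y.length) (s, [], x, y)).map readOff

/-- The expansion of the product of a word with a star sum, with a prefix. -/
def starWords (s : ℕ) (p u l : List ℕ) : List (ℕ × List ℕ) :=
  (expand starStep (u.length + l.length) (s, p, u, l)).map readOff

/-- The word of an index, outermost letter first. -/
def wordOf (k : List ℕ) : List ℕ := k.foldl (fun w a => prependZeros (a - 1) (1 :: w)) []

/-- The expansion of the convolution product of the words of several indices. -/
def convAll (ks : List (List ℕ)) : List (ℕ × List ℕ) :=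
  ks.foldr (fun k acc => acc.flatMap fun t => convWords t.1 (wordOf k) t.2) [(0, [])]

/-- The expansion of a state in which no letter has to be transported any more. -/
def finish (t : SignedState) : List (ℕ × List ℕ) :=
  if t.2.1 = [] then [] else
    (convWords t.1 t.2.2.1 t.2.2.2).flatMap fun u =>
      starWords u.1 (prependZeros (t.2.1.headI - 1) []) u.2 t.2.1.tail

/-- The expansion of the connected sum of two words and a reversed star index. -/
def pairWords (t : SignedState) : List (ℕ × List ℕ) :=
  (expand transportStep (t.2.2.2.length + t.2.1.length) t).flatMap finish

/-- Put a letter in front of an encoded word. -/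
def consLetter (a : ℕ) (c : List (ℕ × ℕ)) : List (ℕ × ℕ) :=
  if a = 0 then (c.headI.1 + 1, c.headI.2) :: c.tail else (1, a) :: c

/-- The pairs `(k_i, d_i)` encoded by a word, outermost first. -/
def blocks (u : List ℕ) : List (ℕ × ℕ) := u.foldr consLetter []

/-- The output entry of a signed word. -/
def outputEntry (u : ℕ × List ℕ) : ℤ × List (ℕ × ℕ) :=
  (if u.1 % 2 = 0 then 1 else -1, (blocks u.2).reverse)

/-- The evaluation algorithm for multiple connected sums. -/
def evalAlgorithm (q : List (List ℕ) × List ℕ) : List (ℤ × List (ℕ × ℕ)) :=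
  ((convAll q.1.tail).flatMap fun t =>
    pairWords (t.1, q.2.reverse, t.2, wordOf q.1.headI)).map outputEntry

/-! ### Primitive recursiveness of the algorithm -/

/-- The recursion in `expand` branches over a list of states. Rewriting it as plain iteration on the
whole list of pending states makes `Primrec.nat_iterate` applicable. -/
theorem iterate_flatMap_eq {σ : Type} (step : σ → List σ) (n : ℕ) (L : List σ) :
    (fun L : List σ => L.flatMap step)^[n] L = L.flatMap (expand step n) := by
  induction n generalizing L with
  | zero => simp [expand]
  | succ n ih => simp [ih, List.flatMap_assoc, expand]

theorem primrec_expand {σ : Type} [Primcodable σ] {step : σ → List σ} (h : Primrec step) :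
    Primrec₂ (expand step) := by
  have h1 : Primrec fun q : ℕ × σ => (fun L : List σ => L.flatMap step)^[q.1] [q.2] :=
    Primrec.nat_iterate Primrec.fst (Primrec.list_cons.comp Primrec.snd (Primrec.const []))
      (Primrec.list_flatMap Primrec.snd (h.comp Primrec.snd).to₂).to₂
  exact h1.of_eq fun q => by simp [iterate_flatMap_eq]

theorem primrec_zeroFlag : Primrec zeroFlag :=
  Primrec.ite (Primrec.eq.comp Primrec.id (Primrec.const 0)) (Primrec.const 1) (Primrec.const 0)

theorem primrec_prependZeros : Primrec₂ prependZeros :=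
  Primrec.nat_iterate Primrec.fst Primrec.snd
    (Primrec.list_cons.comp (Primrec.const 0) Primrec.snd).to₂

theorem primrec_state_prefix : Primrec fun t : SignedState => t.2.1 :=
  Primrec.fst.comp Primrec.snd

theorem primrec_state_left : Primrec fun t : SignedState => t.2.2.1 :=
  Primrec.fst.comp (Primrec.snd.comp Primrec.snd)

theorem primrec_state_right : Primrec fun t : SignedState => t.2.2.2 :=
  Primrec.snd.comp (Primrec.snd.comp Primrec.snd)

theorem primrec_convStep : Primrec convStep := by
  have hx := primrec_state_left
  have hy := primrec_state_right
  have hp := primrec_state_prefix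
  have ha := Primrec.list_headI.comp hx
  have hb := Primrec.list_headI.comp hy
  have hc := Primrec.nat_add.comp ha hb
  have hsc := Primrec.nat_add.comp (Primrec.fst (α := ℕ) (β := List ℕ × List ℕ × List ℕ))
    (primrec_zeroFlag.comp hc)
  have hnil := Primrec.const (α := SignedState) ([] : List ℕ)
  have h1 := Primrec.list_cons.comp (Primrec.id (α := SignedState)) (Primrec.const [])
  refine Primrec.ite (Primrec.eq.comp hx hnil) h1 (Primrec.ite (Primrec.eq.comp hy hnil) h1 ?_)
  refine Primrec.list_cons.comp ?_ (Primrec.list_cons.comp ?_ (Primrec.const []))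
  · exact (Primrec.nat_add.comp hsc (primrec_zeroFlag.comp ha)).pair
      ((Primrec.list_cons.comp hc hp).pair ((Primrec.list_tail.comp hx).pair hy))
  · exact (Primrec.nat_add.comp hsc (primrec_zeroFlag.comp hb)).pair
      ((Primrec.list_cons.comp hc hp).pair (hx.pair (Primrec.list_tail.comp hy)))

theorem primrec_starStep : Primrec starStep := by
  have hs := Primrec.fst (α := ℕ) (β := List ℕ × List ℕ × List ℕ)
  have hx := primrec_state_left
  have hy := primrec_state_right
  have hp := primrec_state_prefix
  have ha := Primrec.list_headI.comp hx
  have hb := Primrec.list_headI.comp hy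
  have hnil := Primrec.const (α := SignedState) ([] : List ℕ)
  have h1 := Primrec.list_cons.comp (Primrec.id (α := SignedState)) (Primrec.const [])
  refine Primrec.ite (Primrec.eq.comp hy hnil) h1 (Primrec.ite (Primrec.eq.comp hx hnil)
    (Primrec.const []) (Primrec.ite (Primrec.eq.comp ha (Primrec.const 0)) ?_ ?_))
  · exact Primrec.list_cons.comp (hs.pair ((Primrec.list_cons.comp (Primrec.const 0) hp).pair
      ((Primrec.list_tail.comp hx).pair hy))) (Primrec.const [])
  · refine Primrec.list_cons.comp ?_ (Primrec.list_cons.comp ?_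
      (Primrec.list_cons.comp ?_ (Primrec.const [])))
    · exact hs.pair ((Primrec.list_cons.comp ha hp).pair ((Primrec.list_tail.comp hx).pair hy))
    · exact hs.pair ((primrec_prependZeros.comp hb hp).pair
        (hx.pair (Primrec.list_tail.comp hy)))
    · exact hs.pair ((primrec_prependZeros.comp (Primrec.nat_sub.comp hb (Primrec.const 1))
        (Primrec.list_cons.comp ha hp)).pair (hx.pair (Primrec.list_tail.comp hy)))

theorem primrec_transportStep : Primrec transportStep := by
  have hs := Primrec.fst (α := ℕ) (β := List ℕ × List ℕ × List ℕ)
  have hx := primrec_state_left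
  have hy := primrec_state_right
  have hp := primrec_state_prefix
  have hb := Primrec.list_headI.comp hy
  have hty := Primrec.list_tail.comp hy
  have htp := Primrec.list_tail.comp hp
  have hnil := Primrec.const (α := SignedState) ([] : List ℕ)
  have h1 := Primrec.list_cons.comp (Primrec.id (α := SignedState)) (Primrec.const [])
  have hcons (a : ℕ) := Primrec.list_cons.comp (Primrec.const (α := SignedState) a) hx
  refine Primrec.ite (Primrec.eq.comp hp hnil) (Primrec.const [])
    (Primrec.ite (Primrec.eq.comp (Primrec.list_headI.comp hp) (Primrec.const 1))
      (Primrec.ite (Primrec.eq.comp hy hnil) h1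
        (Primrec.ite (Primrec.eq.comp hb (Primrec.const 0)) ?_ ?_)) h1)
  · exact Primrec.list_cons.comp (hs.pair (hp.pair ((hcons 1).pair hty)))
      (Primrec.list_cons.comp ((Primrec.nat_add.comp hs (Primrec.const 1)).pair
        (htp.pair ((hcons 1).pair hy))) (Primrec.const []))
  · exact Primrec.list_cons.comp (hs.pair (hp.pair ((hcons 0).pair hty)))
      (Primrec.list_cons.comp (hs.pair (htp.pair ((hcons 0).pair hy))) (Primrec.const []))

theorem primrec_readOff : Primrec readOff :=
  Primrec.fst.pair (Primrec.list_append.comp (Primrec.list_reverse.comp primrec_state_prefix)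
    (Primrec.list_append.comp primrec_state_left primrec_state_right))

theorem primrec_convWords :
    Primrec fun q : ℕ × List ℕ × List ℕ => convWords q.1 q.2.1 q.2.2 := by
  have hx : Primrec fun q : ℕ × List ℕ × List ℕ => q.2.1 := Primrec.fst.comp Primrec.snd
  have hy : Primrec fun q : ℕ × List ℕ × List ℕ => q.2.2 := Primrec.snd.comp Primrec.snd
  exact Primrec.list_map ((primrec_expand primrec_convStep).comp
    (Primrec.nat_add.comp (Primrec.list_length.comp hx) (Primrec.list_length.comp hy))
    (Primrec.fst.pair ((Primrec.const []).pair (hx.pair hy)))) (primrec_readOff.comp Primrec.snd).to₂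

theorem primrec_starWords :
    Primrec fun t : SignedState => starWords t.1 t.2.1 t.2.2.1 t.2.2.2 :=
  Primrec.list_map ((primrec_expand primrec_starStep).comp
    (Primrec.nat_add.comp (Primrec.list_length.comp primrec_state_left)
      (Primrec.list_length.comp primrec_state_right)) Primrec.id)
    (primrec_readOff.comp Primrec.snd).to₂

theorem primrec_wordOf : Primrec wordOf := by
  refine Primrec.list_foldl (h := fun _ q => prependZeros (q.2 - 1) (1 :: q.1))
    Primrec.id (Primrec.const []) ?_
  have hw : Primrec fun q : List ℕ × List ℕ × ℕ => q.2.1 := Primrec.fst.comp Primrec.snd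
  have ha : Primrec fun q : List ℕ × List ℕ × ℕ => q.2.2 := Primrec.snd.comp Primrec.snd
  exact (primrec_prependZeros.comp (Primrec.nat_sub.comp ha (Primrec.const 1))
    (Primrec.list_cons.comp (Primrec.const 1) hw)).to₂

theorem primrec_convAll : Primrec convAll := by
  have hL : Primrec fun z : List (List ℕ) × List ℕ × List (ℕ × List ℕ) => z.2.2 :=
    Primrec.snd.comp Primrec.snd
  have hg : Primrec fun q : (List (List ℕ) × List ℕ × List (ℕ × List ℕ)) × ℕ × List ℕ =>
      convWords q.2.1 (wordOf q.1.2.1) q.2.2 :=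
    primrec_convWords.comp ((Primrec.fst.comp Primrec.snd).pair
      ((primrec_wordOf.comp (Primrec.fst.comp (Primrec.snd.comp Primrec.fst))).pair
        (Primrec.snd.comp Primrec.snd)))
  exact Primrec.list_foldr Primrec.id (Primrec.const [(0, [])])
    (Primrec.list_flatMap hL hg.to₂).to₂

theorem primrec_finish : Primrec finish := by
  have hl := primrec_state_prefix
  refine Primrec.ite (Primrec.eq.comp hl (Primrec.const [])) (Primrec.const [])
    (Primrec.list_flatMap (primrec_convWords.comp (Primrec.fst.pair
      (primrec_state_left.pair primrec_state_right))) ?_)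
  have hl' := hl.comp (Primrec.fst (α := SignedState) (β := ℕ × List ℕ))
  exact (primrec_starWords.comp ((Primrec.fst.comp Primrec.snd).pair
    ((primrec_prependZeros.comp (Primrec.nat_sub.comp (Primrec.list_headI.comp hl')
      (Primrec.const 1)) (Primrec.const [])).pair
      ((Primrec.snd.comp Primrec.snd).pair (Primrec.list_tail.comp hl'))))).to₂

theorem primrec_pairWords : Primrec pairWords :=
  Primrec.list_flatMap ((primrec_expand primrec_transportStep).comp
    (Primrec.nat_add.comp (Primrec.list_length.comp primrec_state_right)
      (Primrec.list_length.comp primrec_state_prefix)) Primrec.id)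
    (primrec_finish.comp Primrec.snd).to₂

theorem primrec_blocks : Primrec blocks := by
  refine Primrec.list_foldr (h := fun _ q => consLetter q.1 q.2) Primrec.id (Primrec.const []) ?_
  have ha : Primrec fun q : List ℕ × ℕ × List (ℕ × ℕ) => q.2.1 := Primrec.fst.comp Primrec.snd
  have hc : Primrec fun q : List ℕ × ℕ × List (ℕ × ℕ) => q.2.2 := Primrec.snd.comp Primrec.snd
  have hh := Primrec.list_headI.comp hc
  exact (Primrec.ite (Primrec.eq.comp ha (Primrec.const 0))
    (Primrec.list_cons.comp ((Primrec.succ.comp (Primrec.fst.comp hh)).pair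
      (Primrec.snd.comp hh)) (Primrec.list_tail.comp hc))
    (Primrec.list_cons.comp ((Primrec.const 1).pair ha) hc)).to₂

theorem primrec_outputEntry : Primrec outputEntry :=
  (Primrec.ite (Primrec.eq.comp (Primrec.nat_mod.comp Primrec.fst (Primrec.const 2))
    (Primrec.const 0)) (Primrec.const 1) (Primrec.const (-1))).pair
    (Primrec.list_reverse.comp (primrec_blocks.comp Primrec.snd))

theorem primrec_evalAlgorithm : Primrec evalAlgorithm := by
  refine Primrec.list_map (Primrec.list_flatMap
    (primrec_convAll.comp (Primrec.list_tail.comp Primrec.fst)) ?_)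
    (primrec_outputEntry.comp Primrec.snd).to₂
  have hq : Primrec fun x : (List (List ℕ) × List ℕ) × ℕ × List ℕ => x.1 := Primrec.fst
  exact (primrec_pairWords.comp ((Primrec.fst.comp Primrec.snd).pair
    ((Primrec.list_reverse.comp (Primrec.snd.comp hq)).pair ((Primrec.snd.comp Primrec.snd).pair
      (primrec_wordOf.comp (Primrec.list_headI.comp (Primrec.fst.comp hq))))))).to₂

/-! ### Words, star sums and their coefficient sequences -/

/-- The coefficientwise effect of integrating against the form of a letter: `dx/x` for `0` and
`dx/(a-x)` for `a > 0`. -/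
noncomputable def letterOp (a : ℕ) : (ℕ → ℝ) →ₗ[ℝ] (ℕ → ℝ) where
  toFun f m := (m : ℝ)⁻¹ *
    if a = 0 then f m else ∑ i ∈ Finset.range m, ((a : ℝ)⁻¹) ^ (m - i) * f i
  map_add' f g := by
    ext m
    split_ifs <;> simp [mul_add, Finset.sum_add_distrib]
  map_smul' c f := by
    ext m
    split_ifs
    · simp; ring
    · simp only [Pi.smul_apply, smul_eq_mul, Finset.mul_sum, RingHom.id_apply]
      exact Finset.sum_congr rfl fun i _ => by ring

/-- Apply the letters of a reversed prefix. -/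
noncomputable def prefixOp : List ℕ → (ℕ → ℝ) →ₗ[ℝ] (ℕ → ℝ)
  | [] => LinearMap.id
  | a :: p => prefixOp p ∘ₗ letterOp a

/-- The coefficients of the polylogarithm of a word. -/
noncomputable def coef : List ℕ → ℕ → ℝ
  | [] => fun m => if m = 0 then 1 else 0
  | a :: u => letterOp a (coef u)

/-- The terms of the star sum of a reversed index. -/
noncomputable def starCoef : List ℕ → ℕ → ℝ
  | [] => fun m => if m = 0 then 1 else 0
  | a :: l => fun m => ((m : ℝ)⁻¹) ^ a * ∑ q ∈ Finset.range (m + 1), starCoef l q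

/-- The truncated star sum of a reversed index. -/
noncomputable def starSum (l : List ℕ) (m : ℕ) : ℝ := ∑ q ∈ Finset.range (m + 1), starCoef l q

/-- The connector of two numbers. -/
noncomputable def conn (i j : ℕ) : ℝ := (i.factorial * j.factorial : ℝ) / ((i + j).factorial : ℝ)

/-- The connected product of two sequences. -/
noncomputable def connProd (f g : ℕ → ℝ) (m : ℕ) : ℝ :=
  ∑ q ∈ Finset.HasAntidiagonal.antidiagonal m, conn q.1 q.2 * (f q.1 * g q.2)

/-- The sign attached to a letter. -/
def letterSign (a : ℕ) : ℝ := (-1) ^ zeroFlag a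

/-- The innermost letter of the word, if there is one, is `1`. -/
def EndsInOne : List ℕ → Prop
  | [] => True
  | a :: u => (u = [] → a = 1) ∧ EndsInOne u

/-- The value of a list of signed words. -/
noncomputable def signedCoef (L : List (ℕ × List ℕ)) : ℕ → ℝ :=
  (L.map fun t => ((-1 : ℝ) ^ t.1) • coef t.2).sum

theorem signedCoef_nil : signedCoef [] = 0 := rfl

theorem signedCoef_append (L L' : List (ℕ × List ℕ)) :
    signedCoef (L ++ L') = signedCoef L + signedCoef L' := by
  simp [signedCoef]

theorem signedCoef_cons (t : ℕ × List ℕ) (L : List (ℕ × List ℕ)) :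
    signedCoef (t :: L) = ((-1 : ℝ) ^ t.1) • coef t.2 + signedCoef L := by
  simp [signedCoef]

theorem letterOp_apply (a : ℕ) (f : ℕ → ℝ) (m : ℕ) : letterOp a f m = (m : ℝ)⁻¹ *
    if a = 0 then f m else ∑ i ∈ Finset.range m, ((a : ℝ)⁻¹) ^ (m - i) * f i := rfl

theorem letterOp_zero_right (a : ℕ) (f : ℕ → ℝ) : letterOp a f 0 = 0 := by
  simp [letterOp_apply]

theorem coef_zero {u : List ℕ} (h : u ≠ []) : coef u 0 = 0 := by
  cases u with
  | nil => exact absurd rfl h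
  | cons a u => exact letterOp_zero_right _ _

theorem letterSign_mul_self (a : ℕ) : letterSign a * letterSign a = 1 := by
  simp [letterSign, ← mul_pow]

/-- This is the coefficient form of `(a - x) F' = ± f`, with the minus sign for `a = 0`. At `a = 0`,
`m = 0` it would fail unless `f 0 = 0`, whence the hypothesis. -/
theorem letterOp_recurrence {a : ℕ} {f : ℕ → ℝ} (h : a = 0 → f 0 = 0) (m : ℕ) :
    (a : ℝ) * ((m + 1 : ℕ) * letterOp a f (m + 1)) =
      m * letterOp a f m + letterSign a * f m := by
  have hm : ((m + 1 : ℕ) : ℝ) ≠ 0 := by positivity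
  by_cases ha : a = 0
  · subst ha
    rcases Nat.eq_zero_or_pos m with rfl | hm0
    · simp [h rfl]
    · have : (m : ℝ) ≠ 0 := by positivity
      simp [letterOp_apply, letterSign, zeroFlag, this]
  · have ha' : (a : ℝ) ≠ 0 := by exact_mod_cast ha
    have h1 : (m : ℝ) * letterOp a f m =
        ∑ i ∈ Finset.range m, ((a : ℝ)⁻¹) ^ (m - i) * f i := by
      rcases Nat.eq_zero_or_pos m with rfl | hm0
      · simp
      · have : (m : ℝ) ≠ 0 := by positivity
        simp [letterOp_apply, ha, this]
    rw [h1, letterOp_apply, if_neg ha, mul_inv_cancel_left₀ hm, Finset.sum_range_succ,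
      mul_add, Finset.mul_sum]
    congr 1
    · refine Finset.sum_congr rfl fun i hi => ?_
      have : m + 1 - i = (m - i) + 1 := by have := Finset.mem_range.1 hi; omega
      rw [this, pow_succ]; field_simp
    · simp [letterSign, zeroFlag, ha]

/-- The differential equation and the vanishing constant term determine the solution: directly for
`c = 0`, by induction on the coefficient index otherwise. -/
theorem eq_letterOp_of_recurrence {c : ℕ} {f D : ℕ → ℝ} (h0 : f 0 = 0) (hD : c = 0 → D 0 = 0)
    (h : ∀ m : ℕ, (c : ℝ) * ((m + 1 : ℕ) * f (m + 1)) = m * f m + letterSign c * D m) :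
    f = letterOp c D := by
  ext m
  by_cases hc : c = 0
  · subst hc
    rcases Nat.eq_zero_or_pos m with rfl | hm
    · rw [h0, letterOp_zero_right]
    · have h1 := h m
      have hm' : (m : ℝ) ≠ 0 := by positivity
      simp only [Nat.cast_zero, zero_mul, letterSign, zeroFlag, if_true, pow_one] at h1
      rw [letterOp_apply, if_pos rfl]
      field_simp
      linarith
  · induction m with
    | zero => rw [h0, letterOp_zero_right]
    | succ m ih =>
      have h1 := h m
      have h2 := letterOp_recurrence hD m
      rw [ih, ← h2] at h1
      have hc' : (c : ℝ) ≠ 0 := by exact_mod_cast hc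
      have hm : ((m + 1 : ℕ) : ℝ) ≠ 0 := by positivity
      exact mul_left_cancel₀ hm (mul_left_cancel₀ hc' h1)

/-! ### The connected product of two words -/

theorem conn_comm (i j : ℕ) : conn i j = conn j i := by
  simp [conn, mul_comm, add_comm]

theorem conn_succ_left (i j : ℕ) :
    conn (i + 1) j * ((i + 1 + j : ℕ) : ℝ) = ((i + 1 : ℕ) : ℝ) * conn i j := by
  have h : (i + 1 + j).factorial = (i + 1 + j) * (i + j).factorial := by
    rw [show i + 1 + j = (i + j) + 1 by ring, Nat.factorial_succ]
  have h1 : ((i + j).factorial : ℝ) ≠ 0 := by positivity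
  have h2 : ((i + 1 + j : ℕ) : ℝ) ≠ 0 := by positivity
  rw [conn, conn, h, Nat.factorial_succ]
  push_cast at h2 ⊢
  field_simp

theorem conn_zero_left (j : ℕ) : conn 0 j = 1 := by
  simp [conn, (Nat.cast_ne_zero.2 j.factorial_ne_zero : (j.factorial : ℝ) ≠ 0)]

theorem connProd_comm (f g : ℕ → ℝ) : connProd f g = connProd g f := by
  ext m
  rw [connProd, connProd, ← Finset.Nat.sum_antidiagonal_swap]
  exact Finset.sum_congr rfl fun q _ => by rw [Prod.fst_swap, Prod.snd_swap, conn_comm]; ring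

theorem connProd_unit_left (g : ℕ → ℝ) : connProd (coef []) g = g := by
  ext m
  rw [connProd, Finset.sum_eq_single (0, m)]
  · simp [conn_zero_left, coef]
  · rintro ⟨i, j⟩ hq hne
    have : i ≠ 0 := by
      rintro rfl
      simp at hq; exact hne (by simp [hq])
    simp [coef, this]
  · simp

theorem connProd_unit_right (g : ℕ → ℝ) : connProd g (coef []) = g := by
  rw [connProd_comm, connProd_unit_left]

/-- Differentiating one factor has the effect of differentiating the connected product: `(i+1) conn
i j = (i+1+j) conn (i+1) j`, and the boundary term drops out because `F 0 = 0`. -/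
theorem connProd_shift {F : ℕ → ℝ} (hF : F 0 = 0) (g : ℕ → ℝ) (m : ℕ) :
    ∑ q ∈ Finset.HasAntidiagonal.antidiagonal m, conn q.1 q.2 * (((q.1 + 1 : ℕ) * F (q.1 + 1)) * g q.2) =
      (m + 1 : ℕ) * connProd F g (m + 1) := by
  rw [connProd, Finset.Nat.antidiagonal_succ, Finset.sum_cons, Finset.sum_map, hF, mul_add,
    Finset.mul_sum]
  simp only [zero_mul, mul_zero, zero_add]
  refine Finset.sum_congr rfl fun q hq => ?_
  have h1 := conn_succ_left q.1 q.2
  have h2 : q.1 + 1 + q.2 = m + 1 := by have := Finset.HasAntidiagonal.mem_antidiagonal.1 hq; omega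
  rw [h2] at h1
  simp only [Function.Embedding.prodMap, Function.Embedding.coeFn_mk, Prod.map, Nat.succ_eq_add_one,
    Function.Embedding.refl_apply]
  linear_combination (-F (q.1 + 1) * g q.2) * h1

/-- The connected product satisfies the differential equation of the letter `a + b`. Multiply the
equations of the two factors by the other factor and add: both derivative terms become the
derivative of the product, so their coefficients `a` and `b` add up, and the Euler operator is a
derivation. -/
theorem connProd_letterOp {a b : ℕ} {f g : ℕ → ℝ} (ha : a = 0 → f 0 = 0) (hb : b = 0 → g 0 = 0) :
    connProd (letterOp a f) (letterOp b g) = letterSign (a + b) • letterOp (a + b)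
      (letterSign a • connProd f (letterOp b g) + letterSign b • connProd (letterOp a f) g) := by
  set F := letterOp a f with hF
  set G := letterOp b g with hG
  have hF0 : F 0 = 0 := letterOp_zero_right _ _
  have hG0 : G 0 = 0 := letterOp_zero_right _ _
  rw [← map_smul]
  refine eq_letterOp_of_recurrence (by simp [connProd, hF0]) (by simp [connProd, hF0, hG0])
    fun m => ?_
  have h1 := connProd_shift hF0 G m
  have h2 := connProd_shift hG0 F m
  rw [← connProd_comm F G, ← Finset.Nat.sum_antidiagonal_swap] at h2
  -- The weights `i` and `j` from the two recurrences combine to `m` on the antidiagonal.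
  have h3 : ∑ q ∈ Finset.HasAntidiagonal.antidiagonal m, conn q.1 q.2 * ((a : ℝ) * (((q.1 + 1 : ℕ) * F (q.1 + 1)) * G q.2)
      + b * (((q.2 + 1 : ℕ) * G (q.2 + 1)) * F q.1)) = ∑ q ∈ Finset.HasAntidiagonal.antidiagonal m,
      conn q.1 q.2 * (m * (F q.1 * G q.2) + letterSign a * (f q.1 * G q.2)
        + letterSign b * (F q.1 * g q.2)) := by
    refine Finset.sum_congr rfl fun q hq => ?_
    have e1 := letterOp_recurrence ha q.1
    have e2 := letterOp_recurrence hb q.2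
    have e3 : (q.1 : ℝ) + q.2 = m := by exact_mod_cast Finset.HasAntidiagonal.mem_antidiagonal.1 hq
    rw [← hF] at e1
    rw [← hG] at e2
    rw [← e3]
    linear_combination (conn q.1 q.2 * G q.2) * e1 + (conn q.1 q.2 * F q.1) * e2
  have h4 : (a + b : ℝ) * ((m + 1 : ℕ) * connProd F G (m + 1)) = m * connProd F G m
      + letterSign a * connProd f G m + letterSign b * connProd F g m := by
    rw [add_mul]
    nth_rewrite 1 [← h1]
    rw [← h2]
    simp only [connProd, Finset.mul_sum, ← Finset.sum_add_distrib, Prod.fst_swap, Prod.snd_swap]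
    refine Eq.trans (Finset.sum_congr rfl fun q _ => ?_) (h3.trans (Finset.sum_congr rfl fun q _ => ?_))
    · rw [conn_comm q.2 q.1]; ring
    · ring
  push_cast at h4 ⊢
  simp only [Pi.smul_apply, Pi.add_apply, smul_eq_mul]
  rw [h4, ← mul_assoc (letterSign (a + b)), letterSign_mul_self]
  ring

theorem coef_reverse_append (p u : List ℕ) : coef (p.reverse ++ u) = prefixOp p (coef u) := by
  induction p generalizing u with
  | nil => rfl
  | cons a p ih => rw [List.reverse_cons, List.append_assoc, ih]; rfl

theorem coef_reverse (p : List ℕ) : coef p.reverse = prefixOp p (coef []) := by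
  rw [← coef_reverse_append, List.append_nil]

theorem convStep_cons (s : ℕ) (p : List ℕ) (a b : ℕ) (v w : List ℕ) :
    convStep (s, p, a :: v, b :: w) =
      [(s + zeroFlag (a + b) + zeroFlag a, (a + b) :: p, v, b :: w),
        (s + zeroFlag (a + b) + zeroFlag b, (a + b) :: p, a :: v, w)] := by
  simp [convStep]

theorem convStep_of_nil {t : SignedState} (h : t.2.2.1 = [] ∨ t.2.2.2 = []) : convStep t = [t] := by
  unfold convStep
  split_ifs with h1 h2 <;> simp_all

theorem expand_of_fixed {σ : Type} {step : σ → List σ} {t : σ} (h : step t = [t]) (n : ℕ) :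
    expand step n t = [t] := by
  induction n with
  | zero => rfl
  | succ n ih => simp [expand, h, ih]

theorem EndsInOne.head_zero {a : ℕ} {u : List ℕ} (h : EndsInOne (a :: u)) (ha : a = 0) : coef u 0 = 0 :=
  coef_zero fun hu => by have := h.1 hu; omega

/-- Each step is the product rule and removes one letter from one of the words, so the total length
is enough fuel. A state with an empty word is fixed by the step, so surplus fuel is harmless. -/
theorem signedCoef_expand_conv (n s : ℕ) (p x y : List ℕ) (hx : EndsInOne x) (hy : EndsInOne y)
    (hn : x.length + y.length ≤ n) :
    signedCoef ((expand convStep n (s, p, x, y)).map readOff) =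
      ((-1 : ℝ) ^ s) • prefixOp p (connProd (coef x) (coef y)) := by
  induction n generalizing s p x y with
  | zero =>
    have h1 : x = [] := List.length_eq_zero_iff.1 (by omega)
    have h2 : y = [] := List.length_eq_zero_iff.1 (by omega)
    subst h1 h2
    simp [expand, readOff, signedCoef, coef_reverse, connProd_unit_left]
  | succ n ih =>
    rcases x with _ | ⟨a, v⟩
    · rw [expand_of_fixed (convStep_of_nil (Or.inl rfl)), connProd_unit_left]
      simp [readOff, signedCoef, coef_reverse_append]
    rcases y with _ | ⟨b, w⟩
    · rw [expand_of_fixed (convStep_of_nil (Or.inr rfl)), connProd_unit_right]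
      simp [readOff, signedCoef, coef_reverse_append]
    simp only [List.length_cons] at hn
    rw [expand, convStep_cons]
    simp only [List.flatMap_cons, List.flatMap_nil, List.append_nil, List.map_append,
      signedCoef_append]
    rw [ih _ _ _ _ hx.2 hy (by simp; omega), ih _ _ _ _ hx hy.2 (by simp; omega)]
    have h := connProd_letterOp (a := a) (b := b) (hx.head_zero) (hy.head_zero)
    change _ = _ • prefixOp p (connProd (letterOp a (coef v)) (letterOp b (coef w)))
    rw [h]
    simp only [prefixOp, LinearMap.comp_apply, map_add, map_smul, pow_add, letterSign, smul_add,
      smul_smul, coef]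
    congr 1 <;> congr 1 <;> ring

theorem signedCoef_convWords (s : ℕ) (x y : List ℕ) (hx : EndsInOne x) (hy : EndsInOne y) :
    signedCoef (convWords s x y) = ((-1 : ℝ) ^ s) • connProd (coef x) (coef y) :=
  signedCoef_expand_conv _ s [] x y hx hy le_rfl

/-! ### Multiplying a word by a star sum -/

theorem starCoef_cons (a : ℕ) (l : List ℕ) (m : ℕ) :
    starCoef (a :: l) m = ((m : ℝ)⁻¹) ^ a * starSum l m := rfl

theorem starSum_nil (m : ℕ) : starSum [] m = 1 := by
  simp [starSum, starCoef]

theorem starSum_cons_zero {a : ℕ} (ha : 0 < a) (l : List ℕ) : starSum (a :: l) 0 = 0 := by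
  simp [starSum, starCoef, ha.ne']

theorem prefixOp_prependZeros (n : ℕ) (p : List ℕ) (f : ℕ → ℝ) :
    prefixOp (prependZeros n p) f = prefixOp p fun m : ℕ => ((m : ℝ)⁻¹) ^ n * f m := by
  induction n generalizing f with
  | zero => simp [prependZeros]
  | succ n ih =>
    rw [prependZeros, Function.iterate_succ_apply']
    change prefixOp (prependZeros n p) (letterOp 0 f) = _
    rw [ih]
    congr 1
    ext m
    rw [letterOp_apply, if_pos rfl, pow_succ]
    ring

/-- In the double sum over `i < m` and `q ≤ m`, the outer star variable `q` satisfies `q ≤ i`, `q =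
m` or `i < q < m`; these are the three terms. In the last case the geometric factor splits at `q`,
and the missing `1/q` of the inner integral is taken from `q^b`, leaving exponent `b - 1`. -/
theorem letterOp_mul_starSum {a b : ℕ} (ha : a ≠ 0) (hb : 0 < b) (f : ℕ → ℝ) (l : List ℕ) :
    letterOp a f * starSum (b :: l) = letterOp a (f * starSum (b :: l))
      + (fun m : ℕ => ((m : ℝ)⁻¹) ^ b * (letterOp a f * starSum l) m)
      + letterOp a fun m : ℕ => ((m : ℝ)⁻¹) ^ (b - 1) * (letterOp a f * starSum l) m := by
  set F := letterOp a f with hF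
  set z : ℝ := (a : ℝ)⁻¹ with hz
  obtain ⟨b, rfl⟩ : ∃ c, b = c + 1 := ⟨b - 1, by omega⟩
  have hFm (m : ℕ) : (m : ℝ) * F m = ∑ i ∈ Finset.range m, z ^ (m - i) * f i := by
    rcases Nat.eq_zero_or_pos m with rfl | hm
    · simp
    · have : (m : ℝ) ≠ 0 := by positivity
      rw [hF, letterOp_apply, if_neg ha, mul_inv_cancel_left₀ this]
  ext m
  rcases Nat.eq_zero_or_pos m with rfl | hm
  · simp [hF, letterOp_zero_right]
  have hm' : (m : ℝ) ≠ 0 := by positivity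
  refine mul_left_cancel₀ hm' ?_
  simp only [Pi.mul_apply, Pi.add_apply, letterOp_apply, if_neg ha, mul_add,
    mul_inv_cancel_left₀ hm', Nat.add_sub_cancel, ← hz]
  rw [← mul_assoc, hFm, Finset.sum_mul]
  have h1 : ∀ i ∈ Finset.range m, z ^ (m - i) * f i * starSum ((b + 1) :: l) m =
      z ^ (m - i) * (f i * starSum ((b + 1) :: l) i) +
        ∑ q ∈ Finset.Ico (i + 1) (m + 1), starCoef ((b + 1) :: l) q * z ^ (m - q) *
          (z ^ (q - i) * f i) := by
    intro i hi
    have hi' := Finset.mem_range.1 hi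
    have : starSum ((b + 1) :: l) m = starSum ((b + 1) :: l) i +
        ∑ q ∈ Finset.Ico (i + 1) (m + 1), starCoef ((b + 1) :: l) q :=
      (Finset.sum_range_add_sum_Ico _ (by omega)).symm
    rw [this, mul_add, mul_assoc, Finset.mul_sum]
    congr 1
    refine Finset.sum_congr rfl fun q hq => ?_
    have hq' := Finset.mem_Ico.1 hq
    rw [show m - i = (m - q) + (q - i) by omega, pow_add]
    ring
  rw [Finset.sum_congr rfl h1, Finset.sum_add_distrib, add_assoc]
  congr 1
  have h2 : ∑ i ∈ Finset.range m, ∑ q ∈ Finset.Ico (i + 1) (m + 1),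
      starCoef ((b + 1) :: l) q * z ^ (m - q) * (z ^ (q - i) * f i) =
      ∑ q ∈ Finset.range (m + 1), ∑ i ∈ Finset.range q,
        starCoef ((b + 1) :: l) q * z ^ (m - q) * (z ^ (q - i) * f i) := by
    refine Finset.sum_comm' fun i q => ?_
    simp only [Finset.mem_range, Finset.mem_Ico]
    omega
  -- Splits off the top value `q = m`.
  rw [h2, Finset.sum_range_succ, add_comm]
  congr 1
  · rw [← Finset.mul_sum, ← hFm, starCoef_cons]
    simp; ring
  · refine Finset.sum_congr rfl fun q _ => ?_
    rw [← Finset.mul_sum, ← hFm, starCoef_cons]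
    rcases Nat.eq_zero_or_pos q with rfl | hq
    · simp [hF, letterOp_zero_right]
    · have : (q : ℝ) ≠ 0 := by positivity
      rw [pow_succ]
      field_simp

theorem starStep_zero (s : ℕ) (p v : List ℕ) (b : ℕ) (l : List ℕ) :
    starStep (s, p, 0 :: v, b :: l) = [(s, 0 :: p, v, b :: l)] := by
  simp [starStep]

theorem starStep_pos (s : ℕ) (p v : List ℕ) {a : ℕ} (ha : a ≠ 0) (b : ℕ) (l : List ℕ) :
    starStep (s, p, a :: v, b :: l) = [(s, a :: p, v, b :: l),
      (s, prependZeros b p, a :: v, l), (s, prependZeros (b - 1) (a :: p), a :: v, l)] := by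
  simp [starStep, ha]

theorem starStep_nil_right {t : SignedState} (h : t.2.2.2 = []) : starStep t = [t] := by
  simp [starStep, h]

theorem starStep_nil_left (s : ℕ) (p : List ℕ) (b : ℕ) (l : List ℕ) :
    starStep (s, p, [], b :: l) = [] := by
  simp [starStep]

theorem signedCoef_expand_star (n s : ℕ) (p u l : List ℕ) (hl : ∀ b ∈ l, 0 < b)
    (hn : u.length + l.length ≤ n) :
    signedCoef ((expand starStep n (s, p, u, l)).map readOff) =
      ((-1 : ℝ) ^ s) • prefixOp p (coef u * starSum l) := by
  have hone : starSum [] = 1 := funext starSum_nil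
  induction n generalizing s p u l with
  | zero =>
    have h1 : u = [] := List.length_eq_zero_iff.1 (by omega)
    have h2 : l = [] := List.length_eq_zero_iff.1 (by omega)
    subst h1 h2
    simp [expand, readOff, signedCoef, coef_reverse, hone]
  | succ n ih =>
    rcases l with _ | ⟨b, l⟩
    · rw [expand_of_fixed (starStep_nil_right rfl), hone]
      simp [readOff, signedCoef, coef_reverse_append]
    have hb : 0 < b := hl b (by simp)
    have hl' : ∀ b ∈ l, 0 < b := fun c hc => hl c (by simp [hc])
    simp only [List.length_cons] at hn
    rcases u with _ | ⟨a, v⟩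
    · have : coef [] * starSum (b :: l) = 0 := by
        ext m
        rcases Nat.eq_zero_or_pos m with rfl | hm
        · simp [starSum_cons_zero hb]
        · simp [coef, hm.ne']
      rw [expand, starStep_nil_left, this]
      simp [signedCoef]
    simp only [List.length_cons] at hn
    by_cases ha : a = 0
    · subst ha
      rw [expand, starStep_zero]
      simp only [List.flatMap_cons, List.flatMap_nil, List.append_nil]
      rw [ih _ _ _ _ hl (by simp; omega)]
      congr 1
      change prefixOp p (letterOp 0 _) = prefixOp p (letterOp 0 (coef v) * _)
      congr 1
      ext m
      simp [letterOp_apply, mul_assoc]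
    · rw [expand, starStep_pos _ _ _ ha]
      simp only [List.flatMap_cons, List.flatMap_nil, List.append_nil, List.map_append,
        signedCoef_append]
      rw [ih _ _ _ _ hl (by simp; omega), ih _ _ _ _ hl' (by simp; omega),
        ih _ _ _ _ hl' (by simp; omega), prefixOp_prependZeros, prefixOp_prependZeros]
      change _ = _ • prefixOp p (letterOp a (coef v) * _)
      rw [letterOp_mul_starSum ha hb]
      simp only [prefixOp, LinearMap.comp_apply, map_add, smul_add, coef, add_assoc]

theorem signedCoef_starWords (s : ℕ) (p u l : List ℕ) (hl : ∀ b ∈ l, 0 < b) :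
    signedCoef (starWords s p u l) = ((-1 : ℝ) ^ s) • prefixOp p (coef u * starSum l) :=
  signedCoef_expand_star _ s p u l hl le_rfl

/-! ### Positivity and growth -/

theorem letterOp_nonneg (a : ℕ) {f : ℕ → ℝ} (hf : ∀ m, 0 ≤ f m) (m : ℕ) : 0 ≤ letterOp a f m := by
  rw [letterOp_apply]
  refine mul_nonneg (by positivity) ?_
  split_ifs
  · exact hf m
  · exact Finset.sum_nonneg fun i _ => mul_nonneg (by positivity) (hf i)

theorem coef_nonneg (u : List ℕ) (m : ℕ) : 0 ≤ coef u m := by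
  induction u generalizing m with
  | nil => simp only [coef]; split_ifs <;> norm_num
  | cons a u ih => exact letterOp_nonneg a ih m

theorem starCoef_nonneg (l : List ℕ) (m : ℕ) : 0 ≤ starCoef l m := by
  induction l generalizing m with
  | nil => simp only [starCoef]; split_ifs <;> norm_num
  | cons a l ih => exact mul_nonneg (by positivity) (Finset.sum_nonneg fun i _ => ih i)

theorem starSum_nonneg (l : List ℕ) (m : ℕ) : 0 ≤ starSum l m :=
  Finset.sum_nonneg fun i _ => starCoef_nonneg l i

theorem conn_pos (i j : ℕ) : 0 < conn i j := by
  unfold conn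
  positivity

theorem connProd_nonneg {f g : ℕ → ℝ} (hf : ∀ m, 0 ≤ f m) (hg : ∀ m, 0 ≤ g m) (m : ℕ) :
    0 ≤ connProd f g m :=
  Finset.sum_nonneg fun _ _ => mul_nonneg (conn_pos _ _).le (mul_nonneg (hf _) (hg _))

theorem sqrt_succ_sub_sqrt (m : ℕ) :
    Real.sqrt (m + 1 : ℕ) - Real.sqrt m = (Real.sqrt (m + 1 : ℕ) + Real.sqrt m)⁻¹ := by
  have h1 : Real.sqrt (m + 1 : ℕ) ^ 2 = (m + 1 : ℕ) := Real.sq_sqrt (by positivity)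
  have h2 : Real.sqrt m ^ 2 = (m : ℝ) := Real.sq_sqrt (by positivity)
  have h3 : 0 < Real.sqrt (m + 1 : ℕ) := Real.sqrt_pos.2 (by positivity)
  have h4 : 0 ≤ Real.sqrt m := Real.sqrt_nonneg _
  refine eq_inv_of_mul_eq_one_left ?_
  push_cast at h1 ⊢
  linear_combination h1 - h2

/-- From `√(m+1) ≤ 2√m` one gets `√(m+1) + √m ≤ 4√m`; the constant is not sharp. -/
theorem inv_sqrt_le {m : ℕ} (hm : 0 < m) :
    (Real.sqrt m)⁻¹ ≤ 4 * (Real.sqrt (m + 1 : ℕ) - Real.sqrt m) := by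
  have h0 : (1 : ℝ) ≤ m := by exact_mod_cast hm
  have hs : 0 < Real.sqrt m := Real.sqrt_pos.2 (by positivity)
  have h1 : Real.sqrt (m + 1 : ℕ) ≤ 2 * Real.sqrt m := by
    rw [Real.sqrt_le_left (by positivity), mul_pow, Real.sq_sqrt (by positivity)]
    push_cast
    linarith
  have h3 : 0 < Real.sqrt (m + 1 : ℕ) := Real.sqrt_pos.2 (by positivity)
  rw [sqrt_succ_sub_sqrt, inv_eq_one_div, ← div_eq_mul_inv, div_le_div_iff₀ hs (by positivity)]
  linarith

/-- The bound is of order `m^(-1/2)`, written as a difference so that its partial sums telescope to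
`C √m`. Division by `m` then restores the same order, and the induction closes without tracking
powers of logarithms. -/
theorem exists_coef_le (u : List ℕ) :
    ∃ C : ℝ, 0 ≤ C ∧ ∀ m : ℕ, coef u m ≤ C * (Real.sqrt (m + 1 : ℕ) - Real.sqrt m) := by
  have hd (m : ℕ) : 0 ≤ Real.sqrt (m + 1 : ℕ) - Real.sqrt m :=
    sub_nonneg.2 (Real.sqrt_le_sqrt (by push_cast; linarith))
  induction u with
  | nil =>
    refine ⟨1, zero_le_one, fun m => ?_⟩
    rcases Nat.eq_zero_or_pos m with rfl | hm
    · simp [coef]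
    · simpa [coef, hm.ne'] using hd m
  | cons a u ih =>
    obtain ⟨C, hC, h⟩ := ih
    refine ⟨4 * C, by positivity, fun m => ?_⟩
    rcases Nat.eq_zero_or_pos m with rfl | hm
    · rw [coef_zero (by simp)]
      exact mul_nonneg (by positivity) (hd 0)
    have hm1 : (1 : ℝ) ≤ m := by exact_mod_cast hm
    simp only [coef, letterOp_apply]
    split_ifs with ha
    · calc (m : ℝ)⁻¹ * coef u m ≤ 1 * coef u m :=
            mul_le_mul_of_nonneg_right (inv_le_one_of_one_le₀ hm1) (coef_nonneg u m)
        _ ≤ C * (Real.sqrt (m + 1 : ℕ) - Real.sqrt m) := by rw [one_mul]; exact h m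
        _ ≤ _ := by
          have := mul_nonneg hC (hd m)
          rw [mul_assoc]
          linarith
    · have ha1 : (1 : ℝ) ≤ a := by exact_mod_cast Nat.pos_of_ne_zero ha
      have h1 : ∑ i ∈ Finset.range m, ((a : ℝ)⁻¹) ^ (m - i) * coef u i ≤ C * Real.sqrt m := by
        calc _ ≤ ∑ i ∈ Finset.range m, C * (Real.sqrt (i + 1 : ℕ) - Real.sqrt i) := by
              refine Finset.sum_le_sum fun i _ => le_trans ?_ (h i)
              exact mul_le_of_le_one_left (coef_nonneg u i)
                (pow_le_one₀ (by positivity) (inv_le_one_of_one_le₀ ha1))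
          _ = C * Real.sqrt m := by
              rw [← Finset.mul_sum, Finset.sum_range_sub (fun i : ℕ => Real.sqrt i)]
              simp
      have hs : 0 < Real.sqrt m := Real.sqrt_pos.2 (by positivity)
      calc _ ≤ (m : ℝ)⁻¹ * (C * Real.sqrt m) := mul_le_mul_of_nonneg_left h1 (by positivity)
        _ = C * (Real.sqrt m)⁻¹ := by
          have : (m : ℝ) = Real.sqrt m * Real.sqrt m := (Real.mul_self_sqrt (by positivity)).symm
          nth_rewrite 1 [this]
          field_simp
        _ ≤ C * (4 * (Real.sqrt (m + 1 : ℕ) - Real.sqrt m)) :=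
          mul_le_mul_of_nonneg_left (inv_sqrt_le hm) hC
        _ = _ := by ring

/-- An outermost 0 improves the decay from `m^(-1/2)` to `m^(-3/2)`. -/
theorem summable_coef_zero_cons (u : List ℕ) : Summable (coef (0 :: u)) := by
  obtain ⟨C, hC, h⟩ := exists_coef_le u
  have hs : Summable fun m : ℕ => C * ((m : ℝ) ^ (3 / 2 : ℝ))⁻¹ :=
    (Real.summable_nat_rpow_inv.2 (by norm_num)).mul_left C
  refine Summable.of_nonneg_of_le (coef_nonneg _) (fun m => ?_) hs
  rcases Nat.eq_zero_or_pos m with rfl | hm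
  · rw [coef_zero (by simp)]
    positivity
  have hm0 : (0 : ℝ) < m := by exact_mod_cast hm
  have hsq : 0 < Real.sqrt m := Real.sqrt_pos.2 hm0
  have h1 : (m : ℝ) ^ (3 / 2 : ℝ) = m * Real.sqrt m := by
    rw [Real.sqrt_eq_rpow, show (3 / 2 : ℝ) = 1 + 1 / 2 by norm_num, Real.rpow_add hm0,
      Real.rpow_one]
  have h2 : Real.sqrt (m + 1 : ℕ) - Real.sqrt m ≤ (Real.sqrt m)⁻¹ := by
    rw [sqrt_succ_sub_sqrt]
    exact inv_anti₀ hsq (le_add_of_nonneg_left (Real.sqrt_nonneg _))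
  simp only [coef, letterOp_apply, if_true]
  rw [h1, mul_inv]
  calc _ ≤ (m : ℝ)⁻¹ * (C * (Real.sqrt m)⁻¹) := mul_le_mul_of_nonneg_left
        ((h m).trans (mul_le_mul_of_nonneg_left h2 hC)) (by positivity)
    _ = _ := by ring

/-! ### The telescoping identity and the transport relation -/

-- Cesàro means of a null sequence tend to 0; the extra last term is handled separately.
open Filter Topology in
theorem tendsto_starSum_div_of_starCoef {l : List ℕ} (h : Tendsto (starCoef l) atTop (𝓝 0)) :
    Tendsto (fun m : ℕ => starSum l m / m) atTop (𝓝 0) := by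
  have h2 : Tendsto (fun m : ℕ => starCoef l m / m) atTop (𝓝 0) := by
    refine squeeze_zero'
      (Eventually.of_forall fun m => div_nonneg (starCoef_nonneg l m) (by positivity)) ?_ h
    filter_upwards [eventually_ge_atTop 1] with m hm
    exact div_le_self (starCoef_nonneg l m) (by exact_mod_cast hm)
  have h3 := h.cesaro.add h2
  rw [add_zero] at h3
  refine h3.congr fun m => ?_
  rw [starSum, Finset.sum_range_succ]
  ring

open Filter Topology in
theorem tendsto_starCoef (l : List ℕ) (hl : ∀ b ∈ l, 0 < b) :
    Tendsto (starCoef l) atTop (𝓝 0) := by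
  induction l with
  | nil =>
    refine tendsto_const_nhds.congr' ?_
    filter_upwards [eventually_ge_atTop 1] with m hm
    simp [starCoef, (show m ≠ 0 by omega)]
  | cons a l ih =>
    have hl' := tendsto_starSum_div_of_starCoef (ih fun b hb => hl b (by simp [hb]))
    refine squeeze_zero' (Eventually.of_forall (starCoef_nonneg _)) ?_ hl'
    filter_upwards [eventually_ge_atTop 1] with m hm
    have ha : 0 < a := hl a (by simp)
    rw [starCoef_cons, div_eq_inv_mul]
    refine mul_le_mul_of_nonneg_right ?_ (starSum_nonneg l m)
    exact pow_le_of_le_one (by positivity) (inv_le_one_of_one_le₀ (by exact_mod_cast hm)) ha.ne'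

/-- Equality holds at `i = 1`, and the connector does not increase in `i`. -/
theorem conn_le {i : ℕ} (hi : 0 < i) (j : ℕ) : conn i j ≤ ((j + 1 : ℕ) : ℝ)⁻¹ := by
  obtain ⟨i, rfl⟩ : ∃ c, i = c + 1 := ⟨i - 1, by omega⟩
  induction i with
  | zero =>
    have h := conn_succ_left 0 j
    rw [conn_zero_left, show 0 + 1 + j = j + 1 by ring] at h
    exact (eq_inv_of_mul_eq_one_left (by simpa using h)).le
  | succ i ih =>
    refine le_trans ?_ (ih (by omega))
    have h := conn_succ_left (i + 1) j
    have h1 : (0 : ℝ) < ((i + 1 + 1 + j : ℕ) : ℝ) := by positivity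
    have h2 : ((i + 1 + 1 : ℕ) : ℝ) ≤ ((i + 1 + 1 + j : ℕ) : ℝ) := by push_cast; linarith [(Nat.cast_nonneg j : (0 : ℝ) ≤ j)]
    refine le_of_mul_le_mul_right ?_ h1
    rw [h, mul_comm]
    exact mul_le_mul_of_nonneg_left h2 (conn_pos _ _).le

open Filter Topology in
theorem tendsto_conn_mul_starSum {i : ℕ} (hi : 0 < i) (j : ℕ) (l : List ℕ)
    (hl : ∀ b ∈ l, 0 < b) :
    Tendsto (fun n : ℕ => (i : ℝ)⁻¹ * (conn i (j + n) * starSum l (i + (j + n)))) atTop (𝓝 0) := by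
  have h1 := tendsto_starSum_div_of_starCoef (tendsto_starCoef l hl)
  have h2 : Tendsto (fun n : ℕ => i + (j + n)) atTop atTop :=
    tendsto_atTop_mono (fun n => (by omega : n ≤ i + (j + n))) tendsto_id
  have h3 := h1.comp h2
  refine squeeze_zero (fun n => by have := conn_pos i (j + n); have := starSum_nonneg l (i + (j + n)); positivity)
    (fun n => ?_) h3
  have hi' : (1 : ℝ) ≤ i := by exact_mod_cast hi
  have hn : (0 : ℝ) ≤ ((j + n : ℕ) : ℝ) := by positivity
  have h4 : (i : ℝ)⁻¹ * conn i (j + n) ≤ ((i + (j + n) : ℕ) : ℝ)⁻¹ := by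
    calc (i : ℝ)⁻¹ * conn i (j + n) ≤ (i : ℝ)⁻¹ * ((j + n + 1 : ℕ) : ℝ)⁻¹ :=
          mul_le_mul_of_nonneg_left (conn_le hi _) (by positivity)
      _ = ((i : ℝ) * ((j + n + 1 : ℕ) : ℝ))⁻¹ := by rw [mul_inv]
      _ ≤ _ := by
        refine inv_anti₀ (by positivity) ?_
        push_cast at hn ⊢
        nlinarith
  rw [Function.comp_apply, div_eq_inv_mul, ← mul_assoc]
  exact mul_le_mul_of_nonneg_right h4 (starSum_nonneg l _)

open Filter Topology in
theorem tsum_ofReal_telescope {f h t : ℕ → ℝ} (hf : ∀ n, 0 ≤ f n) (hh : ∀ n, 0 ≤ h n)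
    (ht : ∀ n, 0 ≤ t n) (heq : ∀ n, f n + t (n + 1) = h n + t n)
    (hlim : Tendsto t atTop (𝓝 0)) :
    ∑' n, ENNReal.ofReal (f n) = ENNReal.ofReal (t 0) + ∑' n, ENNReal.ofReal (h n) := by
  have h1 (N : ℕ) : ∑ n ∈ Finset.range N, ENNReal.ofReal (f n) + ENNReal.ofReal (t N) =
      ENNReal.ofReal (t 0) + ∑ n ∈ Finset.range N, ENNReal.ofReal (h n) := by
    rw [← ENNReal.ofReal_sum_of_nonneg fun n _ => hf n,
      ← ENNReal.ofReal_sum_of_nonneg fun n _ => hh n,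
      ← ENNReal.ofReal_add (Finset.sum_nonneg fun n _ => hf n) (ht N),
      ← ENNReal.ofReal_add (ht 0) (Finset.sum_nonneg fun n _ => hh n)]
    congr 1
    induction N with
    | zero => simp
    | succ N ih =>
      rw [Finset.sum_range_succ, Finset.sum_range_succ]
      linarith [heq N]
  have h2 := (ENNReal.tendsto_nat_tsum fun n => ENNReal.ofReal (f n)).add
    (ENNReal.tendsto_ofReal hlim)
  rw [ENNReal.ofReal_zero, add_zero] at h2
  refine tendsto_nhds_unique h2 ?_
  simp_rw [h1]
  exact tendsto_const_nhds.add (ENNReal.tendsto_nat_tsum fun n => ENNReal.ofReal (h n))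

/-- Sums over the numbers exceeding `k`. -/
theorem tsum_ite_lt (k : ℕ) (f : ℕ → ENNReal) :
    ∑' j, (if k < j then f j else 0) = ∑' n, f (k + 1 + n) := by
  rw [← ENNReal.summable.sum_add_tsum_nat_add' (k := k + 1) (f := fun j => if k < j then f j else 0)]
  rw [Finset.sum_eq_zero, zero_add]
  · refine tsum_congr fun n => ?_
    rw [if_pos (by omega), add_comm]
  · intro j hj
    rw [if_neg (by have := Finset.mem_range.1 hj; omega)]

/-- Telescoping of `t j = i⁻¹ * conn i j * starSum l (i + j)`. Passing from `j - 1` to `j` changes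
the connector, which gives the left summand because `i⁻¹ (conn i (j-1) - conn i j) = j⁻¹ conn i j`,
and changes the star sum by its top term, which gives the right summand. -/
theorem tsum_conn_starSum {i : ℕ} (hi : 0 < i) (k : ℕ) (l : List ℕ) (hl : ∀ b ∈ l, 0 < b) :
    ∑' j, (if k < j then ENNReal.ofReal ((j : ℝ)⁻¹ * (conn i j * starSum l (i + j))) else 0) =
      ENNReal.ofReal ((i : ℝ)⁻¹ * (conn i k * starSum l (i + k))) +
        ∑' j, (if k < j then ENNReal.ofReal ((i : ℝ)⁻¹ * ((j : ℝ)⁻¹ *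
          (conn i j * ((i + j : ℕ) * starCoef l (i + j))))) else 0) := by
  rw [tsum_ite_lt, tsum_ite_lt]
  have hc := fun j => (conn_pos i j).le
  have hS := starSum_nonneg l
  have hs := starCoef_nonneg l
  refine tsum_ofReal_telescope
    (t := fun n : ℕ => (i : ℝ)⁻¹ * (conn i (k + n) * starSum l (i + (k + n))))
    (fun n => ?_) (fun n => ?_) (fun n => ?_) (fun n => ?_) (tendsto_conn_mul_starSum hi k l hl)
  · exact mul_nonneg (by positivity) (mul_nonneg (hc _) (hS _))
  · exact mul_nonneg (by positivity) (mul_nonneg (by positivity)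
      (mul_nonneg (hc _) (mul_nonneg (by positivity) (hs _))))
  · exact mul_nonneg (by positivity) (mul_nonneg (hc _) (hS _))
  · have e1 := conn_succ_left (k + n) i
    rw [conn_comm _ i, conn_comm _ i] at e1
    have e2 : starSum l (i + (k + n + 1)) =
        starSum l (i + (k + n)) + starCoef l (i + (k + n + 1)) := Finset.sum_range_succ _ _
    have hi' : (i : ℝ) ≠ 0 := by positivity
    have hj' : ((k + n + 1 : ℕ) : ℝ) ≠ 0 := by positivity
    rw [show k + 1 + n = k + n + 1 by ring, ← add_assoc k n 1, e2]
    rw [show k + n + 1 + i = i + (k + n + 1) by ring] at e1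
    have e3 : conn i (k + n) = ((k + n + 1 : ℕ) : ℝ)⁻¹ * (conn i (k + n + 1) * ((i + (k + n + 1) : ℕ) : ℝ)) := by
      rw [e1]; field_simp
    rw [e3]
    push_cast at hj' ⊢
    field_simp
    ring

/-- The connected sum of two words and a reversed star index, as an extended real. -/
noncomputable def pairSum (v w l : List ℕ) : ENNReal :=
  ∑' (i : ℕ) (j : ℕ), ENNReal.ofReal
    (coef v i * coef w j * (conn i j * ((i + j : ℕ) * starCoef l (i + j))))

theorem pairSum_comm (v w l : List ℕ) : pairSum v w l = pairSum w v l := by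
  rw [pairSum, pairSum, ENNReal.tsum_comm]
  refine tsum_congr fun i => tsum_congr fun j => ?_
  rw [conn_comm, add_comm, mul_comm (coef v j)]

theorem tsum_coef_one_cons (w : List ℕ) {x : ℕ → ℝ} (hx : ∀ j, 0 ≤ x j) :
    ∑' j, ENNReal.ofReal (coef (1 :: w) j * x j) = ∑' k, ENNReal.ofReal (coef w k) *
      ∑' j : ℕ, (if k < j then ENNReal.ofReal ((j : ℝ)⁻¹ * x j) else 0) := by
  simp_rw [← ENNReal.tsum_mul_left]
  rw [ENNReal.tsum_comm]
  refine tsum_congr fun j => ?_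
  rw [tsum_eq_sum (s := Finset.range j)]
  · simp only [coef, letterOp_apply, one_ne_zero, if_false, Nat.cast_one, inv_one, one_pow, one_mul]
    rw [mul_right_comm, Finset.mul_sum, ENNReal.ofReal_sum_of_nonneg]
    · refine Finset.sum_congr rfl fun k hk => ?_
      rw [if_pos (Finset.mem_range.1 hk), ← ENNReal.ofReal_mul (coef_nonneg w k), mul_comm]
    · exact fun k _ => mul_nonneg (mul_nonneg (by positivity) (hx j)) (coef_nonneg w k)
  · intro k hk
    rw [if_neg (by simpa using hk), mul_zero]

theorem mul_starCoef_one {m : ℕ} (hm : 0 < m) (l : List ℕ) :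
    (m : ℝ) * starCoef (1 :: l) m = starSum l m := by
  rw [starCoef_cons, pow_one, mul_inv_cancel_left₀ (by positivity)]

theorem coef_zero_cons (u : List ℕ) (m : ℕ) : coef (0 :: u) m = (m : ℝ)⁻¹ * coef u m := rfl

/-- Transport of the letter `1` from the second word to the letter `0` of the first one. -/
theorem pairSum_transport {v : List ℕ} (hv : v ≠ []) (w : List ℕ) {l : List ℕ}
    (hl : ∀ b ∈ l, 0 < b) :
    pairSum v (1 :: w) (1 :: l) = pairSum (0 :: v) w (1 :: l) + pairSum (0 :: v) (1 :: w) l := by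
  rw [pairSum, pairSum, pairSum, ← ENNReal.tsum_add]
  refine tsum_congr fun i => ?_
  rcases Nat.eq_zero_or_pos i with rfl | hi
  · simp [coef_zero hv, coef_zero_cons]
  have hS := starSum_nonneg l
  have hs := starCoef_nonneg l
  have hc := fun j => (conn_pos i j).le
  have hvi := coef_nonneg v i
  have e (j : ℕ) : ((i + j : ℕ) : ℝ) * starCoef (1 :: l) (i + j) = starSum l (i + j) :=
    mul_starCoef_one (by omega) l
  simp_rw [e]
  have e1 : ∀ j, coef v i * coef (1 :: w) j * (conn i j * starSum l (i + j)) =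
      coef v i * (coef (1 :: w) j * (conn i j * starSum l (i + j))) := fun j => by ring
  have e2 : ∀ j, coef (0 :: v) i * coef (1 :: w) j *
      (conn i j * ((i + j : ℕ) * starCoef l (i + j))) =
      coef v i * (coef (1 :: w) j * ((i : ℝ)⁻¹ * (conn i j * ((i + j : ℕ) * starCoef l (i + j))))) :=
    fun j => by rw [coef_zero_cons]; ring
  have e3 : ∀ j, coef (0 :: v) i * coef w j * (conn i j * starSum l (i + j)) =
      coef v i * (coef w j * ((i : ℝ)⁻¹ * (conn i j * starSum l (i + j)))) :=
    fun j => by rw [coef_zero_cons]; ring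
  simp_rw [e1, e2, e3, ENNReal.ofReal_mul hvi]
  rw [ENNReal.tsum_mul_left, ENNReal.tsum_mul_left, ENNReal.tsum_mul_left, ← mul_add]
  congr 1
  rw [tsum_coef_one_cons w fun j => mul_nonneg (hc j) (hS _),
    tsum_coef_one_cons w fun j => mul_nonneg (by positivity) (mul_nonneg (hc j)
      (mul_nonneg (by positivity) (hs _))), ← ENNReal.tsum_add]
  refine tsum_congr fun k => ?_
  rw [tsum_conn_starSum hi k l hl, ENNReal.ofReal_mul (coef_nonneg w k), ← mul_add]
  congr 2
  refine tsum_congr fun j => ?_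
  rw [mul_left_comm]

/-- The empty star sum is supported at 0, where the factor `i + j` vanishes. -/
theorem pairSum_nil (v w : List ℕ) : pairSum v w [] = 0 := by
  simp only [pairSum, ENNReal.tsum_eq_zero, starCoef]
  intro i j
  by_cases h : i + j = 0
  · rw [h]; simp
  · rw [if_neg h]; simp

theorem tsum_antidiagonal (F : ℕ → ℕ → ENNReal) :
    ∑' (i : ℕ) (j : ℕ), F i j =
      ∑' m : ℕ, ∑ q ∈ Finset.HasAntidiagonal.antidiagonal m, F q.1 q.2 := by
  rw [← ENNReal.tsum_prod, ← Finset.HasAntidiagonal.sigmaAntidiagonalEquivProd.tsum_eq,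
    ENNReal.tsum_sigma']
  refine tsum_congr fun m => ?_
  rw [← Finset.tsum_subtype]
  rfl

/-- Collecting the double series along `i + j = m` connects transport, which fixes one summation
variable, with the word expansions, which work coefficient by coefficient. -/
theorem pairSum_eq_tsum (v w l : List ℕ) : pairSum v w l =
    ∑' m : ℕ, ENNReal.ofReal (connProd (coef v) (coef w) m * (m * starCoef l m)) := by
  rw [pairSum, tsum_antidiagonal fun i j => ENNReal.ofReal
    (coef v i * coef w j * (conn i j * ((i + j : ℕ) * starCoef l (i + j))))]
  refine tsum_congr fun m => ?_
  rw [connProd, Finset.sum_mul, ENNReal.ofReal_sum_of_nonneg]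
  · refine Finset.sum_congr rfl fun q hq => ?_
    rw [Finset.HasAntidiagonal.mem_antidiagonal.1 hq]
    congr 1
    ring
  · exact fun q _ => mul_nonneg (mul_nonneg (conn_pos _ _).le
      (mul_nonneg (coef_nonneg _ _) (coef_nonneg _ _)))
      (mul_nonneg (by positivity) (starCoef_nonneg _ _))

/-! ### Shape of the words produced by the expansions -/

theorem EndsInOne.cons {u : List ℕ} (h : EndsInOne u) (hu : u ≠ []) (a : ℕ) : EndsInOne (a :: u) :=
  ⟨fun h' => absurd h' hu, h⟩

theorem prependZeros_eq (n : ℕ) (p : List ℕ) : prependZeros n p = List.replicate n 0 ++ p := by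
  induction n with
  | zero => rfl
  | succ n ih =>
    rw [prependZeros, Function.iterate_succ_apply']
    change 0 :: prependZeros n p = _
    rw [ih, List.replicate_succ, List.cons_append]

theorem EndsInOne.replicate_append {u : List ℕ} (h : EndsInOne u) (hu : u ≠ []) (n : ℕ) :
    EndsInOne (List.replicate n 0 ++ u) := by
  induction n with
  | zero => exact h
  | succ n ih => exact ih.cons (by simp [hu]) 0

/-- Each step emits one letter and consumes one, so length is preserved. The expansion stops with a
nonempty remainder of one factor whose innermost letter is still 1. -/
theorem mem_expand_conv {A B : ℕ} (n s : ℕ) (p x y : List ℕ) (hx : EndsInOne x) (hy : EndsInOne y)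
    (hA : ∀ a ∈ x, a ≤ A) (hB : ∀ b ∈ y, b ≤ B) (hn : x.length + y.length ≤ n)
    {t : SignedState} (ht : t ∈ expand convStep n (s, p, x, y)) :
    ∃ r, (readOff t).2 = p.reverse ++ r ∧ EndsInOne r ∧ r.length = x.length + y.length ∧
      ∀ a ∈ r, a ≤ A + B := by
  induction n generalizing s p x y with
  | zero =>
    have h1 : x = [] := List.length_eq_zero_iff.1 (by omega)
    have h2 : y = [] := List.length_eq_zero_iff.1 (by omega)
    subst h1 h2
    simp only [expand, List.mem_singleton] at ht
    subst ht
    exact ⟨[], by simp [readOff], trivial, rfl, by simp⟩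
  | succ n ih =>
    rcases x with _ | ⟨a, v⟩
    · rw [expand_of_fixed (convStep_of_nil (Or.inl rfl)), List.mem_singleton] at ht
      subst ht
      exact ⟨y, by simp [readOff], hy, by simp, fun b hb => (hB b hb).trans (by omega)⟩
    rcases y with _ | ⟨b, w⟩
    · rw [expand_of_fixed (convStep_of_nil (Or.inr rfl)), List.mem_singleton] at ht
      subst ht
      exact ⟨a :: v, by simp [readOff], hx, by simp, fun b hb => (hA b hb).trans (by omega)⟩
    have hab : a + b ≤ A + B := add_le_add (hA a (by simp)) (hB b (by simp))
    have key : ∀ r : List ℕ, EndsInOne r → r.length = v.length + w.length + 1 →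
        (∀ a ∈ r, a ≤ A + B) → EndsInOne ((a + b) :: r) ∧
          ((a + b) :: r).length = (a :: v).length + (b :: w).length ∧
          ∀ c ∈ (a + b) :: r, c ≤ A + B := by
      intro r h1 h2 h3
      refine ⟨h1.cons (by rintro rfl; simp at h2) _, by simp [h2]; omega, ?_⟩
      simpa [hab] using h3
    rw [expand, convStep_cons] at ht
    simp only [List.flatMap_cons, List.flatMap_nil, List.append_nil, List.mem_append] at ht
    simp only [List.length_cons] at hn
    rcases ht with ht | ht
    · obtain ⟨r, h1, h2, h3, h4⟩ := ih _ _ _ _ hx.2 hy (fun c hc => hA c (by simp [hc])) hB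
        (by simp; omega) ht
      exact ⟨(a + b) :: r, by simp [h1], key r h2 (by simp [h3]; omega) h4⟩
    · obtain ⟨r, h1, h2, h3, h4⟩ := ih _ _ _ _ hx hy.2 hA (fun c hc => hB c (by simp [hc]))
        (by simp; omega) ht
      exact ⟨(a + b) :: r, by simp [h1], key r h2 (by simp [h3]; omega) h4⟩

theorem mem_convWords {A B s : ℕ} {x y : List ℕ} (hx : EndsInOne x) (hy : EndsInOne y)
    (hA : ∀ a ∈ x, a ≤ A) (hB : ∀ b ∈ y, b ≤ B) {u : ℕ × List ℕ} (hu : u ∈ convWords s x y) :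
    EndsInOne u.2 ∧ u.2.length = x.length + y.length ∧ ∀ a ∈ u.2, a ≤ A + B := by
  obtain ⟨t, ht, rfl⟩ := List.mem_map.1 hu
  obtain ⟨r, h1, h2, h3, h4⟩ := mem_expand_conv _ _ _ _ _ hx hy hA hB le_rfl ht
  rw [h1]
  exact ⟨h2, h3, h4⟩

theorem convWords_nil_right (s : ℕ) (v : List ℕ) : convWords s v [] = [(s, v)] := by
  rw [convWords, expand_of_fixed (convStep_of_nil (Or.inr rfl))]
  simp [readOff]

/-- Using up a star entry `b` adds `b` letters: either `b` zeros, or a copy of the current letter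
and `b - 1` zeros. A leading 0 is copied unchanged, which preserves convergence. -/
theorem mem_expand_star {A : ℕ} (n s : ℕ) (p u l : List ℕ) (hu : EndsInOne u)
    (hA : ∀ a ∈ u, a ≤ A) (hl : ∀ b ∈ l, 0 < b) (hn : u.length + l.length ≤ n)
    {t : SignedState} (ht : t ∈ expand starStep n (s, p, u, l)) :
    ∃ r, (readOff t).2 = p.reverse ++ r ∧ EndsInOne r ∧ r.length = u.length + l.sum ∧
      (∀ a ∈ r, a ≤ A) ∧ (u.head? = some 0 → r.head? = some 0) := by
  induction n generalizing s p u l with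
  | zero =>
    have h1 : u = [] := List.length_eq_zero_iff.1 (by omega)
    have h2 : l = [] := List.length_eq_zero_iff.1 (by omega)
    subst h1 h2
    simp only [expand, List.mem_singleton] at ht
    subst ht
    exact ⟨[], by simp [readOff], trivial, rfl, by simp, by simp⟩
  | succ n ih =>
    rcases l with _ | ⟨b, l⟩
    · rw [expand_of_fixed (starStep_nil_right rfl), List.mem_singleton] at ht
      subst ht
      exact ⟨u, by simp [readOff], hu, by simp, hA, id⟩
    have hb : 0 < b := hl b (by simp)
    have hl' : ∀ b ∈ l, 0 < b := fun c hc => hl c (by simp [hc])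
    rcases u with _ | ⟨a, v⟩
    · rw [expand, starStep_nil_left] at ht
      simp at ht
    simp only [List.length_cons] at hn
    have haA : a ≤ A := hA a (by simp)
    have hvA : ∀ c ∈ v, c ≤ A := fun c hc => hA c (by simp [hc])
    by_cases ha : a = 0
    · subst ha
      rw [expand, starStep_zero] at ht
      simp only [List.flatMap_cons, List.flatMap_nil, List.append_nil] at ht
      obtain ⟨r, h1, h2, h3, h4, -⟩ := ih _ _ _ _ hu.2 hvA hl (by simp; omega) ht
      simp only [List.sum_cons] at h3
      exact ⟨0 :: r, by simp [h1], h2.cons (by rintro rfl; simp at h3; omega) _,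
        by simp [h3]; omega, by simpa using h4, by simp⟩
    rw [expand, starStep_pos _ _ _ ha] at ht
    simp only [List.flatMap_cons, List.flatMap_nil, List.append_nil, List.mem_append] at ht
    have hhead : ∀ r : List ℕ, (a :: v).head? = some 0 → r.head? = some 0 := by simp [ha]
    rcases ht with ht | ht | ht
    · obtain ⟨r, h1, h2, h3, h4, -⟩ := ih _ _ _ _ hu.2 hvA hl (by simp; omega) ht
      simp only [List.sum_cons] at h3
      exact ⟨a :: r, by simp [h1], h2.cons (by rintro rfl; simp at h3; omega) _,
        by simp [h3]; omega, by simpa [haA] using h4, hhead _⟩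
    · obtain ⟨r, h1, h2, h3, h4, -⟩ := ih _ _ _ _ hu hA hl' (by simp; omega) ht
      refine ⟨List.replicate b 0 ++ r, by simp [h1, prependZeros_eq],
        h2.replicate_append (by rintro rfl; simp at h3; omega) _, by simp [h3]; omega, ?_, hhead _⟩
      intro c hc
      rcases List.mem_append.1 hc with hc | hc
      · simp [List.eq_of_mem_replicate hc]
      · exact h4 c hc
    · obtain ⟨r, h1, h2, h3, h4, -⟩ := ih _ _ _ _ hu hA hl' (by simp; omega) ht
      have hr : r ≠ [] := by rintro rfl; simp at h3; omega
      refine ⟨a :: (List.replicate (b - 1) 0 ++ r), by simp [h1, prependZeros_eq],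
        (h2.replicate_append hr _).cons (by simp [hr]) _, by simp [h3]; omega, ?_, hhead _⟩
      intro c hc
      rcases List.mem_cons.1 hc with rfl | hc
      · exact haA
      rcases List.mem_append.1 hc with hc | hc
      · simp [List.eq_of_mem_replicate hc]
      · exact h4 c hc

theorem mem_starWords {A s k : ℕ} {u l : List ℕ} (hu : EndsInOne u) (hne : u ≠ [])
    (hA : ∀ a ∈ u, a ≤ A) (hl : ∀ b ∈ l, 0 < b) (hk : k = 0 → u.head? = some 0) {t : ℕ × List ℕ}
    (ht : t ∈ starWords s (prependZeros k []) u l) :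
    EndsInOne t.2 ∧ t.2.length = k + u.length + l.sum ∧ (∀ a ∈ t.2, a ≤ A) ∧
      t.2.head? = some 0 := by
  obtain ⟨t, ht', rfl⟩ := List.mem_map.1 ht
  obtain ⟨r, h1, h2, h3, h4, h5⟩ := mem_expand_star _ _ _ _ _ hu hA hl le_rfl ht'
  rw [h1, prependZeros_eq, List.append_nil, List.reverse_replicate]
  have hr : r ≠ [] := by
    rintro rfl
    have := List.length_pos_iff.2 hne
    simp at h3
    omega
  refine ⟨h2.replicate_append hr _, by simp [h3]; omega, ?_, ?_⟩
  · intro c hc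
    rcases List.mem_append.1 hc with hc | hc
    · simp [List.eq_of_mem_replicate hc]
    · exact h4 c hc
  · rcases Nat.eq_zero_or_pos k with rfl | hk'
    · simpa using h5 (hk rfl)
    · obtain ⟨k, rfl⟩ : ∃ c, k = c + 1 := ⟨k - 1, by omega⟩
      simp [List.replicate_succ]

/-! ### Evaluating connected sums of two words -/

theorem signedCoef_flatMap {L : List (ℕ × List ℕ)} {f : ℕ × List ℕ → List (ℕ × List ℕ)}
    (T : (ℕ → ℝ) →ₗ[ℝ] (ℕ → ℝ))
    (h : ∀ u ∈ L, signedCoef (f u) = ((-1 : ℝ) ^ u.1) • T (coef u.2)) :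
    signedCoef (L.flatMap f) = T (signedCoef L) := by
  induction L with
  | nil => simp [signedCoef_nil]
  | cons u L ih =>
    rw [List.flatMap_cons, signedCoef_append, signedCoef_cons, map_add, map_smul,
      h u (by simp), ih fun v hv => h v (by simp [hv])]

/-- The words whose series converge and that are admissible for the evaluation. -/
structure Proper (N len : ℕ) (u : List ℕ) : Prop where
  endsInOne : EndsInOne u
  head : u.head? = some 0
  length_eq : u.length = len
  le : ∀ a ∈ u, a ≤ N

theorem Proper.summable {N len : ℕ} {u : List ℕ} (h : Proper N len u) : Summable (coef u) := by
  obtain ⟨v, rfl⟩ : ∃ v, u = 0 :: v := by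
    have := h.head
    cases u with
    | nil => simp at this
    | cons a v => exact ⟨v, by simp_all⟩
  exact summable_coef_zero_cons v

/-- The value of a list of signed words. -/
noncomputable def signedValue (L : List (ℕ × List ℕ)) : ℝ :=
  (L.map fun t => (-1 : ℝ) ^ t.1 * ∑' m, coef t.2 m).sum

theorem signedValue_append (L L' : List (ℕ × List ℕ)) :
    signedValue (L ++ L') = signedValue L + signedValue L' := by
  simp [signedValue]

theorem hasSum_signedCoef {L : List (ℕ × List ℕ)} (h : ∀ t ∈ L, Summable (coef t.2)) :
    HasSum (signedCoef L) (signedValue L) := by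
  induction L with
  | nil => exact hasSum_zero
  | cons t L ih =>
    rw [signedCoef_cons]
    exact ((h t (by simp)).hasSum.mul_left _).add (ih fun u hu => h u (by simp [hu]))

theorem neg_one_pow_mul_self (s : ℕ) : (-1 : ℝ) ^ s * (-1) ^ s = 1 := by
  rw [← mul_pow]; simp

/-- The factor `m * m^(-b)` becomes a prefix of `b - 1` zeros. This prefix is empty for `b = 1`, so
the leading 0 must then come from `v` itself, which is why `w` is required to be empty. -/
theorem finish_spec {A B s b : ℕ} {l v w : List ℕ} (hv : EndsInOne v) (hne : v ≠ [])
    (hw : EndsInOne w) (hA : ∀ a ∈ v, a ≤ A) (hB : ∀ a ∈ w, a ≤ B) (hb : 0 < b)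
    (hl : ∀ b ∈ l, 0 < b) (h1 : b = 1 → w = [] ∧ v.head? = some 0) :
    (∀ u ∈ finish (s, b :: l, v, w), Proper (A + B) (v.length + w.length + l.sum + (b - 1)) u.2) ∧
    signedCoef (finish (s, b :: l, v, w)) = ((-1 : ℝ) ^ s) •
      fun m : ℕ => connProd (coef v) (coef w) m * (m * starCoef (b :: l) m) := by
  have hf : finish (s, b :: l, v, w) = (convWords s v w).flatMap fun u =>
      starWords u.1 (prependZeros (b - 1) []) u.2 l := by simp [finish]
  rw [hf]
  constructor
  · intro t ht
    obtain ⟨u, hu, ht⟩ := List.mem_flatMap.1 ht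
    obtain ⟨h2, h3, h4⟩ := mem_convWords hv hw hA hB hu
    have hpos := List.length_pos_iff.2 hne
    have hk : b - 1 = 0 → u.2.head? = some 0 := by
      intro hb'
      obtain ⟨rfl, hv0⟩ := h1 (by omega)
      rw [convWords_nil_right, List.mem_singleton] at hu
      rw [hu]
      exact hv0
    obtain ⟨h5, h6, h7, h8⟩ := mem_starWords h2 (List.length_pos_iff.1 (by omega)) h4 hl hk ht
    exact ⟨h5, h8, by omega, h7⟩
  · rw [signedCoef_flatMap (prefixOp (prependZeros (b - 1) []) ∘ₗ
      LinearMap.mulRight ℝ (starSum l)) fun u hu => signedCoef_starWords _ _ _ _ hl,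
      signedCoef_convWords _ _ _ hv hw, map_smul]
    congr 1
    rw [LinearMap.comp_apply, LinearMap.mulRight_apply, prefixOp_prependZeros]
    ext m
    change (m : ℝ)⁻¹ ^ (b - 1) * (connProd (coef v) (coef w) m * starSum l m) = _
    rw [starCoef_cons]
    rcases Nat.eq_zero_or_pos m with rfl | hm
    · have : connProd (coef v) (coef w) 0 = 0 := by simp [connProd, coef_zero hne]
      simp [this]
    · obtain ⟨c, rfl⟩ : ∃ c, b = c + 1 := ⟨b - 1, by omega⟩
      have : (m : ℝ) ≠ 0 := by positivity
      rw [Nat.add_sub_cancel, pow_succ]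
      field_simp

/-- Termwise, `finish` gives a signed combination of summable sequences. Since the combined sequence
is nonnegative, its real sum is the extended one, which is therefore finite. -/
theorem pairSum_of_finish {A B s b : ℕ} {l v w : List ℕ} (hv : EndsInOne v) (hne : v ≠ [])
    (hw : EndsInOne w) (hA : ∀ a ∈ v, a ≤ A) (hB : ∀ a ∈ w, a ≤ B) (hb : 0 < b)
    (hl : ∀ b ∈ l, 0 < b) (h1 : b = 1 → w = [] ∧ v.head? = some 0) :
    pairSum v w (b :: l) ≠ ⊤ ∧
      signedValue (finish (s, b :: l, v, w)) = (-1) ^ s * (pairSum v w (b :: l)).toReal := by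
  obtain ⟨h2, h3⟩ := finish_spec (s := s) hv hne hw hA hB hb hl h1
  have h4 := (hasSum_signedCoef fun t ht => (h2 t ht).summable).mul_left ((-1 : ℝ) ^ s)
  rw [h3] at h4
  simp only [Pi.smul_apply, smul_eq_mul, ← mul_assoc, neg_one_pow_mul_self, one_mul] at h4
  have h0 (m : ℕ) : 0 ≤ connProd (coef v) (coef w) m * m * starCoef (b :: l) m :=
    mul_nonneg (mul_nonneg (connProd_nonneg (coef_nonneg v) (coef_nonneg w) m) (by positivity))
      (starCoef_nonneg _ m)
  have h5 : pairSum v w (b :: l) =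
      ENNReal.ofReal ((-1) ^ s * signedValue (finish (s, b :: l, v, w))) := by
    rw [pairSum_eq_tsum, ← h4.tsum_eq, ENNReal.ofReal_tsum_of_nonneg h0 h4.summable]
    simp_rw [mul_assoc]
  rw [h5]
  refine ⟨ENNReal.ofReal_ne_top, ?_⟩
  rw [ENNReal.toReal_ofReal (h4.nonneg h0), ← mul_assoc, neg_one_pow_mul_self, one_mul]

theorem transportStep_fixed {t : SignedState} (h : t.2.1 ≠ [])
    (h' : t.2.1.headI = 1 → t.2.2.2 = []) : transportStep t = [t] := by
  unfold transportStep
  rw [if_neg h]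
  split_ifs <;> simp_all

/-- The transport algorithm evaluates the connected sum of two words. -/
theorem expand_transport_spec {A : ℕ} (hA1 : 1 ≤ A) (n s : ℕ) (l v w : List ℕ) (hv : EndsInOne v)
    (hne : v ≠ []) (hw : EndsInOne w) (hA : ∀ a ∈ v, a ≤ A) (hB : ∀ a ∈ w, a ≤ 1)
    (hl : ∀ b ∈ l, 0 < b) (hw0 : w = [] → v.head? = some 0) (hn : w.length + l.length ≤ n) :
    (∀ u ∈ (expand transportStep n (s, l, v, w)).flatMap finish,
      Proper (A + 1) (v.length + w.length + l.sum - 1) u.2) ∧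
    pairSum v w l ≠ ⊤ ∧
    signedValue ((expand transportStep n (s, l, v, w)).flatMap finish) =
      (-1) ^ s * (pairSum v w l).toReal := by
  induction n generalizing s l v w with
  | zero =>
    -- Every transport shortens `w` or `l`; without fuel the star index is empty, and both sides are
    -- 0.
    have h2 : l = [] := List.length_eq_zero_iff.1 (by omega)
    subst h2
    simp [expand, finish, pairSum_nil, signedValue]
  | succ n ih =>
    have hvpos := List.length_pos_iff.2 hne
    rcases l with _ | ⟨b, l⟩
    · simp [expand, transportStep, pairSum_nil, signedValue]
    have hb : 0 < b := hl b (by simp)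
    have hl' : ∀ b ∈ l, 0 < b := fun c hc => hl c (by simp [hc])
    by_cases hfix : b = 1 → w = []
    · have h1 : b = 1 → w = [] ∧ v.head? = some 0 := fun h => ⟨hfix h, hw0 (hfix h)⟩
      rw [expand_of_fixed (transportStep_fixed (by simp) (by simpa using hfix))]
      simp only [List.flatMap_cons, List.flatMap_nil, List.append_nil]
      have h2 := (finish_spec (s := s) hv hne hw hA hB hb hl' h1).1
      have h3 : v.length + w.length + (b :: l).sum - 1 =
          v.length + w.length + l.sum + (b - 1) := by
        simp; omega
      rw [h3]
      exact ⟨h2, pairSum_of_finish hv hne hw hA hB hb hl' h1⟩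
    -- What remains is the outermost star entry 1 with a letter still to be moved.
    push Not at hfix
    obtain ⟨rfl, hwne⟩ := hfix
    obtain ⟨a, w, rfl⟩ := List.exists_cons_of_ne_nil hwne
    have hBw : ∀ c ∈ w, c ≤ 1 := fun c hc => hB c (by simp [hc])
    have ha : a ≤ 1 := hB a (by simp)
    simp only [List.length_cons] at hn
    obtain rfl | rfl : a = 0 ∨ a = 1 := by omega
    -- The innermost letter is 1, so a 0 is never the last letter of the word.
    · have hw' : w ≠ [] := fun h => by have := hw.1 h; omega
      have hA' : ∀ c ∈ 1 :: v, c ≤ A := by simpa [hA1] using hA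
      obtain ⟨p1, t1, v1⟩ := ih s (1 :: l) (1 :: v) w (hv.cons hne 1) (by simp) hw.2 hA' hBw hl
        (fun h => absurd h hw') (by simp; omega)
      obtain ⟨p2, -, v2⟩ := ih (s + 1) l (1 :: v) (0 :: w) (hv.cons hne 1) (by simp) hw hA' hB hl'
        (by simp) (by simp; omega)
      have hstep : transportStep (s, 1 :: l, v, 0 :: w) =
          [(s, 1 :: l, 1 :: v, w), (s + 1, l, 1 :: v, 0 :: w)] := by simp [transportStep]
      -- The relation is read backwards with the words interchanged: the wanted sum is one of its
      -- two right-hand terms. This causes the minus sign, and finiteness of the left-hand side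
      -- bounds both terms.
      have htr := pairSum_transport hw' v hl'
      rw [pairSum_comm w, pairSum_comm _ v, pairSum_comm _ (1 :: v)] at htr
      rw [htr] at t1 v1
      rw [ENNReal.add_ne_top] at t1
      rw [expand, hstep]
      simp only [List.flatMap_cons, List.flatMap_nil, List.append_nil, List.flatMap_append,
        List.mem_append, signedValue_append]
      refine ⟨?_, t1.1, ?_⟩
      · rintro u (hu | hu)
        · convert p1 u hu using 1
          simp; omega
        · convert p2 u hu using 1
          simp; omega
      · rw [v1, v2, ENNReal.toReal_add t1.1 t1.2]
        ring
    · have hA' : ∀ c ∈ 0 :: v, c ≤ A := by simpa using hA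
      -- Here `w` may become empty, but the transported letter has put a 0 in front of `v`.
      obtain ⟨p1, t1, v1⟩ := ih s (1 :: l) (0 :: v) w (hv.cons hne 0) (by simp) hw.2 hA' hBw hl
        (by simp) (by simp; omega)
      obtain ⟨p2, t2, v2⟩ := ih s l (0 :: v) (1 :: w) (hv.cons hne 0) (by simp) hw hA' hB hl'
        (by simp) (by simp; omega)
      have hstep : transportStep (s, 1 :: l, v, 1 :: w) =
          [(s, 1 :: l, 0 :: v, w), (s, l, 0 :: v, 1 :: w)] := by simp [transportStep]
      rw [pairSum_transport hne w hl', expand, hstep]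
      simp only [List.flatMap_cons, List.flatMap_nil, List.append_nil, List.flatMap_append,
        List.mem_append, signedValue_append]
      refine ⟨?_, ENNReal.add_ne_top.2 ⟨t1, t2⟩, ?_⟩
      · rintro u (hu | hu)
        · convert p1 u hu using 1
          simp; omega
        · convert p2 u hu using 1
          simp; omega
      · rw [v1, v2, ENNReal.toReal_add t1 t2]
        ring

/-! ### Nested sums over chains -/

/-- The terms with a given last entry in a nested sum over strict chains; the parameters are listed
outermost first. -/
noncomputable def chainCoef : List (ℕ × ℝ) → ℕ → ℝ
  | [] => fun m => if m = 0 then 1 else 0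
  | x :: c => fun m => ∑ i ∈ Finset.range m, x.2 ^ (m - i) / (m : ℝ) ^ x.1 * chainCoef c i

theorem chainCoef_nonneg {c : List (ℕ × ℝ)} (hc : ∀ x ∈ c, 0 ≤ x.2) (m : ℕ) :
    0 ≤ chainCoef c m := by
  induction c generalizing m with
  | nil => simp only [chainCoef]; split_ifs <;> norm_num
  | cons x c ih =>
    have hx : 0 ≤ x.2 := hc x (by simp)
    exact Finset.sum_nonneg fun i _ =>
      mul_nonneg (by positivity) (ih (fun y hy => hc y (by simp [hy])) i)

/-- Append an entry to a chain. -/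
def extendChain {r : ℕ} (m : Fin (r + 1) → ℕ) (x : ℕ) : Fin (r + 2) → ℕ := Fin.snoc m x

theorem extendChain_castSucc {r : ℕ} (m : Fin (r + 1) → ℕ) (x : ℕ) (i : Fin (r + 1)) :
    extendChain m x i.castSucc = m i := Fin.snoc_castSucc (α := fun _ => ℕ) _ _ _

theorem extendChain_last {r : ℕ} (m : Fin (r + 1) → ℕ) (x : ℕ) :
    extendChain m x (Fin.last (r + 1)) = x := Fin.snoc_last (α := fun _ => ℕ) _ _

theorem extendChain_zero {r : ℕ} (m : Fin (r + 1) → ℕ) (x : ℕ) : extendChain m x 0 = m 0 :=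
  extendChain_castSucc m x 0

theorem extendChain_init {r : ℕ} (m : Fin (r + 2) → ℕ) :
    extendChain (fun i => m i.castSucc) (m (Fin.last (r + 1))) = m := Fin.snoc_init_self m

theorem strictMono_extendChain {r : ℕ} {m : Fin (r + 1) → ℕ} (hm : StrictMono m) {x : ℕ}
    (hx : m (Fin.last r) < x) : StrictMono (extendChain m x) := by
  rw [Fin.strictMono_iff_lt_succ]
  intro i
  refine Fin.lastCases ?_ (fun j => ?_) i
  · rw [Fin.succ_last, extendChain_last, extendChain_castSucc]
    exact hx
  · rw [Fin.succ_castSucc, extendChain_castSucc, extendChain_castSucc]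
    exact hm Fin.castSucc_lt_succ

theorem monotone_extendChain {r : ℕ} {m : Fin (r + 1) → ℕ} (hm : Monotone m) {x : ℕ}
    (hx : m (Fin.last r) ≤ x) : Monotone (extendChain m x) := by
  rw [Fin.monotone_iff_le_succ]
  intro i
  refine Fin.lastCases ?_ (fun j => ?_) i
  · rw [Fin.succ_last, extendChain_last, extendChain_castSucc]
    exact hx
  · rw [Fin.succ_castSucc, extendChain_castSucc, extendChain_castSucc]
    exact hm Fin.castSucc_lt_succ.le

/-- A strict chain is a shorter one together with a larger last entry. -/
def strictChainSuccEquiv (r : ℕ) :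
    StrictChain (r + 1) ≃ Σ m : StrictChain r, {x : ℕ // m.last < x} where
  toFun m := ⟨⟨fun i => m.1 i.castSucc, m.2.1, fun _ _ h => m.2.2 (by simpa using h)⟩,
    ⟨m.1 (Fin.last (r + 1)), m.2.2 (Fin.castSucc_lt_succ (i := Fin.last r))⟩⟩
  invFun p := ⟨extendChain p.1.1 p.2.1, (extendChain_zero _ _).trans p.1.2.1,
    strictMono_extendChain p.1.2.2 p.2.2⟩
  left_inv m := Subtype.ext (extendChain_init m.1)
  right_inv p := Sigma.subtype_ext
    (Subtype.ext (funext fun i => extendChain_castSucc p.1.1 p.2.1 i))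
    (extendChain_last p.1.1 p.2.1)

theorem tsum_subtype_lt (k : ℕ) (f : ℕ → ENNReal) :
    ∑' x : {x : ℕ // k < x}, f x = ∑' x, (if k < x then f x else 0) := by
  exact (tsum_subtype {x : ℕ | k < x} f).trans
    (tsum_congr fun x => by simp [Set.indicator_apply])

theorem liTerm_nonneg {r : ℕ} {k : Fin r → ℕ} {z : Fin r → ℝ} (hz : ∀ i, 0 ≤ z i)
    (m : StrictChain r) : 0 ≤ liTerm k z m :=
  Finset.prod_nonneg fun i _ => div_nonneg (pow_nonneg (hz i) _) (by positivity)

/-- Peeling off the outermost variable. The arbitrary weight `φ` on the last entry makes the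
induction work, since the sum over that variable becomes the weight for the shorter chain. -/
theorem tsum_liTerm {r : ℕ} (k : Fin r → ℕ) (z : Fin r → ℝ) (hz : ∀ i, 0 ≤ z i)
    (φ : ℕ → ENNReal) :
    ∑' m : StrictChain r, ENNReal.ofReal (liTerm k z m) * φ m.last =
      ∑' i, ENNReal.ofReal (chainCoef (List.ofFn fun i => (k i, z i)).reverse i) * φ i := by
  induction r generalizing φ with
  | zero =>
    let m0 : StrictChain 0 := ⟨fun _ => 0, rfl, Subsingleton.strictMono (α := Fin 1) _⟩
    have hm (m : StrictChain 0) : m = m0 := Subtype.ext (funext fun i => by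
      rw [Subsingleton.elim (α := Fin 1) i 0]; exact m.2.1)
    rw [tsum_eq_single m0 fun m h => absurd (hm m) h, tsum_eq_single 0]
    · simp [liTerm, chainCoef, m0, StrictChain.last]
    · intro i hi
      simp [chainCoef, hi]
  | succ r ih =>
    rw [← (strictChainSuccEquiv r).symm.tsum_eq, ENNReal.tsum_sigma']
    have hk : (List.ofFn fun i => (k i, z i)).reverse = (k (Fin.last r), z (Fin.last r)) ::
        (List.ofFn fun i : Fin r => (k i.castSucc, z i.castSucc)).reverse := by
      rw [List.ofFn_succ', List.concat_eq_append, List.reverse_append]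
      rfl
    set c := (List.ofFn fun i : Fin r => (k i.castSucc, z i.castSucc)).reverse with hc
    set ζ := z (Fin.last r) with hζ
    set κ := k (Fin.last r) with hκ
    have hζ0 : 0 ≤ ζ := hz _
    have hterm (m : StrictChain r) (x : {x : ℕ // m.last < x}) :
        liTerm k z ((strictChainSuccEquiv r).symm ⟨m, x⟩) =
          liTerm (fun i => k i.castSucc) (fun i => z i.castSucc) m *
            (ζ ^ (x.1 - m.last) / (x.1 : ℝ) ^ κ) := by
      rw [liTerm, Fin.prod_univ_castSucc]
      have e1 (i : Fin (r + 1)) : ((strictChainSuccEquiv r).symm ⟨m, x⟩).1 i.castSucc = m.1 i :=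
        extendChain_castSucc _ _ _
      have e2 : ((strictChainSuccEquiv r).symm ⟨m, x⟩).1 (Fin.last (r + 1)) = x.1 :=
        extendChain_last _ _
      simp only [e1, Fin.succ_castSucc, Fin.succ_last, e2]
      rfl
    have hlast (m : StrictChain r) (x : {x : ℕ // m.last < x}) :
        ((strictChainSuccEquiv r).symm ⟨m, x⟩).last = x.1 :=
      extendChain_last _ _
    have h0 (m : StrictChain r) :
        0 ≤ liTerm (fun i => k i.castSucc) (fun i => z i.castSucc) m :=
      liTerm_nonneg (fun i => hz _) m
    have h1 (m : StrictChain r) : ∑' x : {x : ℕ // m.last < x},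
        ENNReal.ofReal (liTerm k z ((strictChainSuccEquiv r).symm ⟨m, x⟩)) *
          φ ((strictChainSuccEquiv r).symm ⟨m, x⟩).last =
        ENNReal.ofReal (liTerm (fun i => k i.castSucc) (fun i => z i.castSucc) m) *
          ∑' x : ℕ, (if m.last < x then
            ENNReal.ofReal (ζ ^ (x - m.last) / (x : ℝ) ^ κ) * φ x else 0) := by
      simp_rw [hterm, hlast, ENNReal.ofReal_mul (h0 m), mul_assoc]
      rw [ENNReal.tsum_mul_left, tsum_subtype_lt m.last fun x =>
        ENNReal.ofReal (ζ ^ (x - m.last) / (x : ℝ) ^ κ) * φ x]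
    simp_rw [h1]
    rw [ih (fun i => k i.castSucc) (fun i => z i.castSucc) (fun i => hz _) fun i =>
      ∑' x : ℕ, (if i < x then ENNReal.ofReal (ζ ^ (x - i) / (x : ℝ) ^ κ) * φ x else 0)]
    simp_rw [← ENNReal.tsum_mul_left]
    rw [ENNReal.tsum_comm, hk]
    have hc0 : ∀ x ∈ c, 0 ≤ x.2 := by
      intro x hx
      rw [hc, List.mem_reverse, List.mem_ofFn] at hx
      obtain ⟨i, rfl⟩ := hx
      exact hz _
    refine tsum_congr fun x => ?_
    rw [tsum_eq_sum (s := Finset.range x), chainCoef, ENNReal.ofReal_sum_of_nonneg, Finset.sum_mul]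
    · refine Finset.sum_congr rfl fun i hi => ?_
      rw [if_pos (Finset.mem_range.1 hi), mul_comm (ζ ^ (x - i) / (x : ℝ) ^ κ),
        ENNReal.ofReal_mul (chainCoef_nonneg hc0 i), mul_assoc]
    · exact fun i _ => mul_nonneg (by positivity) (chainCoef_nonneg hc0 i)
    · intro i hi
      rw [if_neg (by simpa using hi), mul_zero]

/-- A nonempty star chain is a shorter one with a smaller last entry. -/
def starChainSuccEquiv (s N : ℕ) (hN : 0 < N) :
    StarChain (s + 1) N ≃ Σ M : Fin (N + 1), StarChain s M where
  toFun q := ⟨⟨q.1 (Fin.last s).castSucc, Nat.lt_succ_of_le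
      ((q.2.2.2.1 (Fin.le_last _)).trans_eq q.2.2.2.2)⟩,
    ⟨fun i => q.1 i.castSucc, q.2.1, fun i => q.2.2.1 i.castSucc,
      fun _ _ h => q.2.2.2.1 (by simpa using h), rfl⟩⟩
  invFun p := ⟨extendChain p.2.1 N, (extendChain_zero _ _).trans p.2.2.1,
    fun i => Fin.lastCases (motive := fun i => 0 < extendChain p.2.1 N i.succ)
      (hN.trans_eq (extendChain_last p.2.1 N).symm)
      (fun j => (p.2.2.2.1 j).trans_eq (extendChain_castSucc p.2.1 N j.succ).symm) i,
    monotone_extendChain p.2.2.2.2.1 (p.2.2.2.2.2.trans_le (Nat.lt_succ_iff.1 p.1.2)),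
    extendChain_last p.2.1 N⟩
  left_inv q := Subtype.ext ((congrArg (extendChain _) q.2.2.2.2.symm).trans
    (extendChain_init q.1))
  right_inv p := Sigma.subtype_ext
    (Fin.ext ((extendChain_castSucc p.2.1 N (Fin.last s)).trans p.2.2.2.2.2))
    (funext fun i => extendChain_castSucc p.2.1 N i)

theorem tsum_starChain {s : ℕ} (l : Fin s → ℕ) (hl : IsIndex l) (N : ℕ) :
    ∑' q : StarChain s N, ENNReal.ofReal (∏ i : Fin s, 1 / (q.1 i.succ : ℝ) ^ l i) =
      ENNReal.ofReal (starCoef (List.ofFn l).reverse N) := by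
  induction s generalizing N with
  | zero =>
    by_cases hN : N = 0
    · subst hN
      let q0 : StarChain 0 0 := ⟨fun _ => 0, rfl, fun i => i.elim0, fun _ _ _ => le_rfl, rfl⟩
      have hq (q : StarChain 0 0) : q = q0 := Subtype.ext (funext fun i => by
        rw [Subsingleton.elim (α := Fin 1) i 0]; exact q.2.1)
      rw [tsum_eq_single q0 fun q h => absurd (hq q) h]
      simp [starCoef]
    · have : IsEmpty (StarChain 0 N) := ⟨fun q => hN (q.2.2.2.2.symm.trans q.2.1)⟩
      simp [starCoef, hN]
  | succ s ih =>
    have hk : (List.ofFn l).reverse = l (Fin.last s) ::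
        (List.ofFn fun i : Fin s => l i.castSucc).reverse := by
      rw [List.ofFn_succ', List.concat_eq_append, List.reverse_append]
      rfl
    rw [hk, starCoef_cons]
    rcases Nat.eq_zero_or_pos N with rfl | hN
    -- All entries after `q₀` are positive, so none can end at 0.
    · have : IsEmpty (StarChain (s + 1) 0) := ⟨fun q => by
        exact lt_irrefl 0 ((q.2.2.1 (Fin.last s)).trans_eq q.2.2.2.2)⟩
      simp [(hl (Fin.last s)).ne']
    · rw [← (starChainSuccEquiv s N hN).symm.tsum_eq, ENNReal.tsum_sigma', tsum_fintype,
        starSum, Finset.mul_sum, ENNReal.ofReal_sum_of_nonneg fun i _ =>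
          mul_nonneg (by positivity) (starCoef_nonneg _ i), Finset.sum_range]
      refine Finset.sum_congr rfl fun M _ => ?_
      rw [ENNReal.ofReal_mul (by positivity), ← ih (fun i => l i.castSucc) (fun i => hl _),
        ← ENNReal.tsum_mul_left]
      refine tsum_congr fun q => ?_
      rw [← ENNReal.ofReal_mul (by positivity), Fin.prod_univ_castSucc, mul_comm]
      have e1 (i : Fin (s + 1)) :
          ((starChainSuccEquiv s N hN).symm ⟨M, q⟩).1 i.castSucc = q.1 i :=
        extendChain_castSucc _ _ _
      have e2 : ((starChainSuccEquiv s N hN).symm ⟨M, q⟩).1 (Fin.last (s + 1)) = N :=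
        extendChain_last _ _
      simp only [e1, Fin.succ_castSucc, Fin.succ_last, e2]
      rw [one_div, inv_pow]

/-! ### The connector of several indices -/

/-- The inverse multinomial coefficient factors into two-term connectors, so the multiple connected
sum is an iterated connected product. -/
theorem connector_cons {n : ℕ} (a : Fin (n + 1) → ℕ) :
    connector a = conn (a 0) (∑ j : Fin n, a j.succ) * connector fun j : Fin n => a j.succ := by
  have : ((∑ j : Fin n, a j.succ).factorial : ℝ) ≠ 0 := by positivity
  rw [connector, connector, conn, Fin.prod_univ_succ, Fin.sum_univ_succ]
  field_simp

theorem connector_nonneg {n : ℕ} (a : Fin n → ℕ) : 0 ≤ connector a := by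
  unfold connector
  positivity

/-- The connected product of several sequences. -/
noncomputable def connProdFin : {n : ℕ} → (Fin n → ℕ → ℝ) → ℕ → ℝ
  | 0, _ => coef []
  | _ + 1, f => connProd (f 0) (connProdFin fun j => f j.succ)

theorem connProdFin_nonneg {n : ℕ} {f : Fin n → ℕ → ℝ} (hf : ∀ j m, 0 ≤ f j m) (m : ℕ) :
    0 ≤ connProdFin f m := by
  induction n generalizing m with
  | zero => exact coef_nonneg [] m
  | succ n ih => exact connProd_nonneg (hf 0) (ih fun j => hf j.succ) m

theorem ofReal_regroup {a b c d : ℝ} (hc : 0 ≤ c) (hbd : 0 ≤ b * d) (x : ENNReal) :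
    ENNReal.ofReal (a * b * (c * d)) * x =
      ENNReal.ofReal c * (ENNReal.ofReal (b * d) * (ENNReal.ofReal a * x)) := by
  rw [show a * b * (c * d) = c * (b * d) * a by ring, ENNReal.ofReal_mul (mul_nonneg hc hbd),
    ENNReal.ofReal_mul hc, mul_assoc, mul_assoc]

theorem tsum_connector {n : ℕ} (r : Fin n → ℕ) (k : ∀ j, Fin (r j) → ℕ) (φ : ℕ → ENNReal) :
    ∑' m : ∀ j, StrictChain (r j), ENNReal.ofReal (connector (fun j => (m j).last) *
        ∏ j, liTerm (k j) (fun _ => 1) (m j)) * φ (∑ j, (m j).last) =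
      ∑' M, ENNReal.ofReal (connProdFin
        (fun j => chainCoef (List.ofFn fun i => (k j i, (1 : ℝ))).reverse) M) * φ M := by
  induction n generalizing φ with
  | zero =>
    rw [tsum_eq_single default fun m h => absurd (Subsingleton.elim m _) h, tsum_eq_single 0]
    · simp [connProdFin, coef, connector]
    · intro i hi
      simp [connProdFin, coef, hi]
  | succ n ih =>
    rw [← (Fin.consEquiv fun j => StrictChain (r j)).tsum_eq, ENNReal.tsum_prod']
    have hc0 {n : ℕ} {r : Fin n → ℕ} (k : ∀ j, Fin (r j) → ℕ) (j : Fin n) (m : ℕ) :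
        0 ≤ chainCoef (List.ofFn fun i => (k j i, (1 : ℝ))).reverse m := by
      refine chainCoef_nonneg ?_ m
      intro x hx
      rw [List.mem_reverse, List.mem_ofFn] at hx
      obtain ⟨i, rfl⟩ := hx
      exact zero_le_one
    have hli {r : ℕ} (k : Fin r → ℕ) (m : StrictChain r) : 0 ≤ liTerm k (fun _ => 1) m :=
      liTerm_nonneg (fun _ => zero_le_one) m
    have h1 (m0 : StrictChain (r 0)) : ∑' m : ∀ j : Fin n, StrictChain (r j.succ),
        ENNReal.ofReal (connector
          (fun j => (Fin.consEquiv (fun j => StrictChain (r j)) (m0, m) j).last) *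
          ∏ j, liTerm (k j) (fun _ => 1) (Fin.consEquiv (fun j => StrictChain (r j)) (m0, m) j)) *
          φ (∑ j, (Fin.consEquiv (fun j => StrictChain (r j)) (m0, m) j).last) =
        ENNReal.ofReal (liTerm (k 0) (fun _ => 1) m0) *
          ∑' N, ENNReal.ofReal (connProdFin (fun j : Fin n =>
            chainCoef (List.ofFn fun i => (k j.succ i, (1 : ℝ))).reverse) N) *
            (ENNReal.ofReal (conn m0.last N) * φ (m0.last + N)) := by
      rw [← ih (fun j => r j.succ) (fun j => k j.succ)
        (fun N => ENNReal.ofReal (conn m0.last N) * φ (m0.last + N)), ← ENNReal.tsum_mul_left]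
      refine tsum_congr fun m => ?_
      rw [connector_cons, Fin.prod_univ_succ, Fin.sum_univ_succ]
      simp only [Fin.consEquiv_apply, Fin.cons_zero, Fin.cons_succ]
      exact ofReal_regroup (hli _ _) (mul_nonneg (connector_nonneg _)
        (Finset.prod_nonneg fun j _ => hli _ _)) _
    simp_rw [h1]
    rw [tsum_liTerm (k 0) (fun _ => 1) (fun _ => zero_le_one) fun i =>
      ∑' N, ENNReal.ofReal (connProdFin (fun j : Fin n =>
            chainCoef (List.ofFn fun i => (k j.succ i, (1 : ℝ))).reverse) N) *
            (ENNReal.ofReal (conn i N) * φ (i + N))]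
    simp_rw [← ENNReal.tsum_mul_left]
    rw [tsum_antidiagonal fun i N => ENNReal.ofReal
      (chainCoef (List.ofFn fun i => (k 0 i, (1 : ℝ))).reverse i) *
      (ENNReal.ofReal (connProdFin (fun j : Fin n =>
            chainCoef (List.ofFn fun i => (k j.succ i, (1 : ℝ))).reverse) N) *
            (ENNReal.ofReal (conn i N) * φ (i + N)))]
    have hrest := connProdFin_nonneg (f := fun j : Fin n =>
      chainCoef (List.ofFn fun i => (k j.succ i, (1 : ℝ))).reverse)
      (hc0 fun j : Fin n => k j.succ)
    refine tsum_congr fun M => ?_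
    rw [connProdFin, connProd, ENNReal.ofReal_sum_of_nonneg fun q _ => mul_nonneg (conn_pos _ _).le
      (mul_nonneg (hc0 k 0 _) (hrest _)), Finset.sum_mul]
    refine Finset.sum_congr rfl fun q hq => ?_
    rw [Finset.HasAntidiagonal.mem_antidiagonal.1 hq, ENNReal.ofReal_mul (conn_pos _ _).le,
      ENNReal.ofReal_mul (hc0 k 0 _)]
    ring

theorem connectedTerm_nonneg {n : ℕ} {r : Fin n → ℕ} {s : ℕ} (k : ∀ j, Fin (r j) → ℕ)
    (l : Fin s → ℕ) (x : ConnectedChain r s) : 0 ≤ connectedTerm k l x := by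
  unfold connectedTerm
  have := connector_nonneg fun j => (x.1 j).last
  positivity

theorem tsum_connectedTerm {n : ℕ} {r : Fin n → ℕ} {s : ℕ} (k : ∀ j, Fin (r j) → ℕ)
    (l : Fin s → ℕ) (hl : IsIndex l) :
    ∑' x : ConnectedChain r s, ENNReal.ofReal (connectedTerm k l x) =
      ∑' M : ℕ, ENNReal.ofReal (connProdFin
        (fun j => chainCoef (List.ofFn fun i => (k j i, (1 : ℝ))).reverse) M) *
        ENNReal.ofReal (M * starCoef (List.ofFn l).reverse M) := by
  rw [← tsum_connector r k fun M => ENNReal.ofReal (M * starCoef (List.ofFn l).reverse M)]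
  unfold ConnectedChain
  rw [ENNReal.tsum_sigma']
  refine tsum_congr fun m => ?_
  have hc : 0 ≤ connector (fun j => (m j).last) * ∏ j, liTerm (k j) (fun _ => 1) (m j) :=
    mul_nonneg (connector_nonneg _)
      (Finset.prod_nonneg fun j _ => liTerm_nonneg (fun _ => zero_le_one) _)
  rw [ENNReal.ofReal_mul (Nat.cast_nonneg (∑ j, (m j).last)),
    ← tsum_starChain l hl (∑ j, (m j).last), ← ENNReal.tsum_mul_left, ← ENNReal.tsum_mul_left]
  refine tsum_congr fun q => ?_
  rw [← ENNReal.ofReal_mul (Nat.cast_nonneg _), ← ENNReal.ofReal_mul hc]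
  congr 1
  have hq : q.1 (Fin.last s) = ∑ j, (m j).last := q.2.2.2.2
  simp only [connectedTerm, liTerm, one_pow]
  rw [hq]

theorem hasSum_of_tsum_ofReal {ι : Type*} {f : ι → ℝ} (hf : ∀ i, 0 ≤ f i) {a : ENNReal}
    (h : ∑' i, ENNReal.ofReal (f i) = a) (ha : a ≠ ⊤) : HasSum f a.toReal := by
  have h1 : Summable f := by
    have h2 := ENNReal.summable_toReal (h ▸ ha)
    exact h2.congr fun i => ENNReal.toReal_ofReal (hf i)
  rw [← h, ← ENNReal.ofReal_tsum_of_nonneg hf h1, ENNReal.toReal_ofReal (tsum_nonneg hf)]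
  exact h1.hasSum

/-! ### Translation between indices and words -/

theorem coef_prependZeros (n : ℕ) (u : List ℕ) (m : ℕ) :
    coef (prependZeros n u) m = ((m : ℝ)⁻¹) ^ n * coef u m := by
  induction n with
  | zero => simp [prependZeros]
  | succ n ih =>
    rw [prependZeros, Function.iterate_succ_apply']
    change coef (0 :: prependZeros n u) m = _
    rw [coef_zero_cons, ih, pow_succ]
    ring

theorem wordOf_concat (k : List ℕ) (a : ℕ) :
    wordOf (k ++ [a]) = prependZeros (a - 1) (1 :: wordOf k) := by
  simp [wordOf]

theorem coef_wordOf {k : List ℕ} (hk : ∀ a ∈ k, 0 < a) :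
    coef (wordOf k) = chainCoef (k.reverse.map fun a => (a, (1 : ℝ))) := by
  induction k using List.reverseRecOn with
  | nil => rfl
  | append_singleton k a ih =>
    ext m
    have ha : 0 < a := hk a (by simp)
    obtain ⟨b, rfl⟩ : ∃ b, a = b + 1 := ⟨a - 1, by omega⟩
    rw [wordOf_concat, coef_prependZeros, List.reverse_append, List.reverse_singleton,
      List.singleton_append, List.map_cons, chainCoef, ← ih fun c hc => hk c (by simp [hc])]
    simp only [coef, letterOp_apply, one_ne_zero, if_false, Nat.cast_one, inv_one, one_pow, one_mul,
      Nat.add_sub_cancel, Finset.mul_sum]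
    refine Finset.sum_congr rfl fun i _ => ?_
    rw [one_div, ← inv_pow, pow_succ, mul_assoc]

theorem wordOf_spec {k : List ℕ} (hk : ∀ a ∈ k, 0 < a) :
    EndsInOne (wordOf k) ∧ (wordOf k).length = k.sum ∧ ∀ a ∈ wordOf k, a ≤ 1 := by
  induction k using List.reverseRecOn with
  | nil => exact ⟨trivial, rfl, by simp [wordOf]⟩
  | append_singleton k a ih =>
    obtain ⟨h1, h2, h3⟩ := ih fun c hc => hk c (by simp [hc])
    have ha : 0 < a := hk a (by simp)
    rw [wordOf_concat, prependZeros_eq]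
    refine ⟨EndsInOne.replicate_append (u := 1 :: wordOf k) ⟨fun _ => rfl, h1⟩ (by simp) _, by simp [h2]; omega, ?_⟩
    intro c hc
    rcases List.mem_append.1 hc with hc | hc
    · simp [List.eq_of_mem_replicate hc]
    · rcases List.mem_cons.1 hc with rfl | hc
      · exact le_rfl
      · exact h3 c hc

/-- Each new factor has letters at most 1, so the bound on the letters grows by one per index. -/
theorem convAll_ofFn_spec {n : ℕ} (k : Fin n → List ℕ) (hk : ∀ j, ∀ a ∈ k j, 0 < a) :
    signedCoef (convAll (List.ofFn k)) = connProdFin (fun j => coef (wordOf (k j))) ∧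
      ∀ u ∈ convAll (List.ofFn k), EndsInOne u.2 ∧ u.2.length = ∑ j, (k j).sum ∧
        ∀ a ∈ u.2, a ≤ n := by
  induction n with
  | zero =>
    rw [List.ofFn_zero]
    refine ⟨by simp [convAll, signedCoef, connProdFin], ?_⟩
    intro u hu
    have : u = (0, []) := by simpa [convAll] using hu
    subst this
    exact ⟨trivial, by simp, by simp⟩
  | succ n ih =>
    obtain ⟨h1, h2⟩ := ih (fun j => k j.succ) fun j => hk j.succ
    obtain ⟨w1, w2, w3⟩ := wordOf_spec (hk 0)
    have hcons : convAll (List.ofFn k) = (convAll (List.ofFn fun j => k j.succ)).flatMap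
        fun t => convWords t.1 (wordOf (k 0)) t.2 := by
      rw [List.ofFn_succ]
      rfl
    rw [hcons]
    constructor
    · let T : (ℕ → ℝ) →ₗ[ℝ] (ℕ → ℝ) :=
        { toFun := connProd (coef (wordOf (k 0)))
          map_add' := fun f g => by
            ext m
            simp [connProd, mul_add, Finset.sum_add_distrib]
          map_smul' := fun c f => by
            ext m
            simp only [connProd, Pi.smul_apply, smul_eq_mul, Finset.mul_sum, RingHom.id_apply]
            exact Finset.sum_congr rfl fun q _ => by ring }
      rw [signedCoef_flatMap T fun u hu => signedCoef_convWords _ _ _ w1 (h2 u hu).1, h1]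
      rfl
    · intro t ht
      obtain ⟨u, hu, ht⟩ := List.mem_flatMap.1 ht
      obtain ⟨u1, u2, u3⟩ := h2 u hu
      obtain ⟨t1, t2, t3⟩ := mem_convWords w1 u1 w3 u3 ht
      refine ⟨t1, ?_, fun a ha => (t3 a ha).trans (by omega)⟩
      rw [t2, w2, u2, Fin.sum_univ_succ]

theorem blocks_cons (a : ℕ) (u : List ℕ) : blocks (a :: u) = consLetter a (blocks u) := rfl

/-- A letter 0 divides by `m`, raising the outermost exponent by one; a positive letter opens a new
block of exponent 1. A leading 0 thus forces an outermost exponent of at least 2 and depth below the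
word length. -/
theorem blocks_spec {N : ℕ} {u : List ℕ} (h : EndsInOne u) (hne : u ≠ []) (hN : ∀ a ∈ u, a ≤ N) :
    ∃ x c, blocks u = x :: c ∧ coef u = chainCoef ((x :: c).map fun y => (y.1, 1 / (y.2 : ℝ))) ∧
      ((x :: c).map Prod.fst).sum = u.length ∧ (∀ y ∈ x :: c, 0 < y.1 ∧ 1 ≤ y.2 ∧ y.2 ≤ N) ∧
      (x :: c).length ≤ u.length ∧ ((x :: c).getLast (by simp)).2 = 1 ∧
      (u.head? = some 0 → 2 ≤ x.1 ∧ (x :: c).length + 1 ≤ u.length) := by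
  induction u with
  | nil => exact absurd rfl hne
  | cons a u ih =>
    have haN : a ≤ N := hN a (by simp)
    by_cases hu : u = []
    · subst hu
      obtain rfl : a = 1 := h.1 rfl
      refine ⟨(1, 1), [], rfl, ?_, by simp, by simpa using haN, by simp, by simp, by simp⟩
      ext m
      simp only [coef, letterOp_apply, List.map_cons, List.map_nil, chainCoef, one_ne_zero,
        if_false, Finset.mul_sum]
      exact Finset.sum_congr rfl fun i _ => by simp
    · obtain ⟨x, c, h1, h2, h3, h4, h5, h6, -⟩ := ih h.2 hu fun b hb => hN b (by simp [hb])
      by_cases ha : a = 0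
      · subst ha
        refine ⟨(x.1 + 1, x.2), c, by simp [blocks_cons, consLetter, h1], ?_, ?_, ?_, ?_, ?_, ?_⟩
        · ext m
          rw [coef_zero_cons, h2]
          simp only [List.map_cons, chainCoef, Finset.mul_sum]
          refine Finset.sum_congr rfl fun i _ => ?_
          rw [pow_succ, div_eq_mul_inv _ ((m : ℝ) ^ x.1), div_eq_mul_inv _ ((m : ℝ) ^ x.1 * m), mul_inv]
          ring
        · simp only [List.map_cons, List.sum_cons, List.length_cons] at h3 ⊢
          omega
        · intro y hy
          rcases List.mem_cons.1 hy with rfl | hy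
          · exact ⟨Nat.succ_pos _, (h4 x (by simp)).2⟩
          · exact h4 y (by simp [hy])
        · simp only [List.length_cons] at h5 ⊢
          omega
        · cases c with
          | nil => simpa using h6
          | cons y c => simpa using h6
        · intro _
          have := (h4 x (by simp)).1
          simp only [List.length_cons] at h5 ⊢
          omega
      · refine ⟨(1, a), x :: c, by simp [blocks_cons, consLetter, h1, ha], ?_, ?_, ?_, ?_, ?_, ?_⟩
        · ext m
          rw [List.map_cons, chainCoef, ← h2]
          simp only [coef, letterOp_apply, if_neg ha, Finset.mul_sum, pow_one, one_div]
          exact Finset.sum_congr rfl fun i _ => by rw [div_eq_mul_inv]; ring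
        · rw [List.map_cons, List.sum_cons, h3, List.length_cons]
          omega
        · intro y hy
          rcases List.mem_cons.1 hy with rfl | hy
          · exact ⟨one_pos, Nat.pos_of_ne_zero ha, haN⟩
          · exact h4 y hy
        · rw [List.length_cons, List.length_cons (as := u)]
          omega
        · rw [List.getLast_cons (by simp)]
          exact h6
        · simp [ha]

theorem weight_codeIndex (p : List (ℕ × ℕ)) : weight (codeIndex p) = (p.map Prod.fst).sum := by
  rw [weight, ← List.sum_ofFn]
  congr 1
  conv_rhs => rw [← List.ofFn_get p, List.map_ofFn]
  rfl

theorem Proper.isMPLParam {N len : ℕ} {u : List ℕ} (h : Proper N len u) :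
    IsMPLParam N (len + 1) (codeIndex (blocks u).reverse) (codeArg (blocks u).reverse) := by
  have hne : u ≠ [] := by
    rintro rfl
    simpa using h.head
  obtain ⟨x, c, h1, -, h3, h4, -, h6, h7⟩ := blocks_spec h.endsInOne hne h.le
  obtain ⟨h7, h8⟩ := h7 h.head
  rw [h.length_eq] at h3 h8
  rw [h1]
  have hmem (i : Fin (x :: c).reverse.length) : (x :: c).reverse.get i ∈ x :: c :=
    List.mem_reverse.1 (List.get_mem _ i)
  refine ⟨by simp, by simpa using Nat.succ_le_succ h8, fun i => (h4 _ (hmem i)).1, ?_, ?_, ?_, ?_⟩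
  · intro i hi
    have e : (x :: c).reverse.get i = x := by
      have hi' : (i : ℕ) = c.length := by simpa using hi
      simp [List.get_eq_getElem, hi']
    rw [codeIndex, e]
    exact h7
  · rw [weight_codeIndex, ← h3, List.map_reverse, List.sum_reverse]
  · intro i hi
    have e : (x :: c).reverse.get i = (x :: c).getLast (by simp) := by
      simp only [List.get_eq_getElem, hi, List.getElem_zero, List.head_reverse]
    rw [codeArg, e, h6]
    simp
  · intro i
    exact ⟨_, (h4 _ (hmem i)).2.1, (h4 _ (hmem i)).2.2, rfl⟩

theorem codeArg_nonneg (p : List (ℕ × ℕ)) (i : Fin p.length) : 0 ≤ codeArg p i := by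
  unfold codeArg
  positivity

theorem Proper.hasSum_liTerm {N len : ℕ} {u : List ℕ} (h : Proper N len u) :
    HasSum (liTerm (codeIndex (blocks u).reverse) (codeArg (blocks u).reverse))
      (∑' m, coef u m) := by
  have hne : u ≠ [] := by
    rintro rfl
    simpa using h.head
  obtain ⟨x, c, h1, h2, -⟩ := blocks_spec h.endsInOne hne h.le
  have hz := codeArg_nonneg (blocks u).reverse
  have key := tsum_liTerm (codeIndex (blocks u).reverse) (codeArg (blocks u).reverse) hz 1
  have e : (List.ofFn fun i => (codeIndex (blocks u).reverse i, codeArg (blocks u).reverse i)).reverse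
      = (blocks u).map fun y => (y.1, 1 / (y.2 : ℝ)) := by
    have : (List.ofFn fun i => (codeIndex (blocks u).reverse i, codeArg (blocks u).reverse i)) =
        (blocks u).reverse.map fun y => (y.1, 1 / (y.2 : ℝ)) := by
      conv_rhs => rw [← List.ofFn_get (blocks u).reverse, List.map_ofFn]
      rfl
    rw [this, List.map_reverse, List.reverse_reverse]
  rw [e, h1, ← h2] at key
  rw [← h1] at key
  simp only [Pi.one_apply, mul_one] at key
  rw [← ENNReal.ofReal_tsum_of_nonneg (coef_nonneg u) h.summable] at key
  have := hasSum_of_tsum_ofReal (liTerm_nonneg hz) key ENNReal.ofReal_ne_top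
  rwa [ENNReal.toReal_ofReal (tsum_nonneg (coef_nonneg u))] at this

/-! ### Assembling the theorem -/

theorem connProd_add_left (f f' g : ℕ → ℝ) (m : ℕ) :
    connProd (f + f') g m = connProd f g m + connProd f' g m := by
  simp [connProd, add_mul, mul_add, Finset.sum_add_distrib]

theorem connProd_smul_left (c : ℝ) (f g : ℕ → ℝ) (m : ℕ) :
    connProd (c • f) g m = c * connProd f g m := by
  simp only [connProd, Pi.smul_apply, smul_eq_mul, Finset.mul_sum]
  exact Finset.sum_congr rfl fun q _ => by ring

theorem hasSum_pairSum {v w l : List ℕ} (h : pairSum v w l ≠ ⊤) :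
    HasSum (fun m : ℕ => connProd (coef v) (coef w) m * (m * starCoef l m))
      (pairSum v w l).toReal :=
  hasSum_of_tsum_ofReal (fun m => mul_nonneg (connProd_nonneg (coef_nonneg v) (coef_nonneg w) m)
    (mul_nonneg (by positivity) (starCoef_nonneg l m))) (pairSum_eq_tsum v w l).symm h

theorem hasSum_signedCoef_connProd {w l : List ℕ} {L : List (ℕ × List ℕ)}
    (h : ∀ t ∈ L, pairSum t.2 w l ≠ ⊤ ∧
      signedValue (pairWords (t.1, l, t.2, w)) = (-1) ^ t.1 * (pairSum t.2 w l).toReal) :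
    HasSum (fun m : ℕ => connProd (signedCoef L) (coef w) m * (m * starCoef l m))
      (signedValue (L.flatMap fun t => pairWords (t.1, l, t.2, w))) := by
  induction L with
  | nil => simp [signedCoef, connProd, signedValue]
  | cons t L ih =>
    obtain ⟨h1, h2⟩ := h t (by simp)
    rw [List.flatMap_cons, signedValue_append, h2, signedCoef_cons]
    have h3 := ((hasSum_pairSum h1).mul_left ((-1 : ℝ) ^ t.1)).add
      (ih fun u hu => h u (by simp [hu]))
    refine h3.congr_fun ?_
    intro m
    rw [connProd_add_left, connProd_smul_left]
    ring

theorem pairWords_spec {A s : ℕ} {l v w : List ℕ} (hA1 : 1 ≤ A) (hv : EndsInOne v) (hne : v ≠ [])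
    (hw : EndsInOne w) (hwne : w ≠ []) (hA : ∀ a ∈ v, a ≤ A) (hB : ∀ a ∈ w, a ≤ 1)
    (hl : ∀ b ∈ l, 0 < b) :
    (∀ u ∈ pairWords (s, l, v, w), Proper (A + 1) (v.length + w.length + l.sum - 1) u.2) ∧
    pairSum v w l ≠ ⊤ ∧
    signedValue (pairWords (s, l, v, w)) = (-1) ^ s * (pairSum v w l).toReal :=
  expand_transport_spec hA1 _ s l v w hv hne hw hA hB hl (fun h => absurd h hwne) le_rfl

theorem evalAlgorithm_ofFn {n : ℕ} (k : Fin (n + 1) → List ℕ) (l : List ℕ) :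
    evalAlgorithm (List.ofFn k, l) = ((convAll (List.ofFn fun j => k j.succ)).flatMap fun t =>
      pairWords (t.1, l.reverse, t.2, wordOf (k 0))).map outputEntry := by
  rw [evalAlgorithm, List.ofFn_succ]
  rfl

theorem outputEntry_sign (s : ℕ) : (((if s % 2 = 0 then 1 else -1 : ℤ)) : ℝ) = (-1) ^ s := by
  split_ifs with h
  · simp [(Nat.even_iff.2 h).neg_one_pow]
  · simp [(Nat.odd_iff.2 (by omega : s % 2 = 1)).neg_one_pow]

theorem theorem1p1 :
    ∃ A : List (List ℕ) × List ℕ → List (ℤ × List (ℕ × ℕ)), Computable A ∧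
      ∀ (n : ℕ) (r : Fin n → ℕ) (s : ℕ) (k : ∀ j, Fin (r j) → ℕ) (l : Fin s → ℕ) (K : ℕ),
        2 ≤ n → (∀ j, 0 < r j) → 0 < s → (∀ j, IsIndex (k j)) → IsIndex l →
        K = (∑ j, weight (k j)) + weight l →
        Summable (connectedTerm k l) ∧
        (∀ t ∈ A (List.ofFn (fun j => List.ofFn (k j)), List.ofFn l),
          IsMPLParam n K (codeIndex t.2) (codeArg t.2) ∧
            Summable (liTerm (codeIndex t.2) (codeArg t.2))) ∧
        connectedSum k l =
          ((A (List.ofFn (fun j => List.ofFn (k j)), List.ofFn l)).map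
            (fun t => (t.1 : ℝ) * liSh (codeIndex t.2) (codeArg t.2))).sum ∧
        connectedSum k l ∈ Submodule.span ℤ (MPL n K) := by
  refine ⟨evalAlgorithm, primrec_evalAlgorithm.to_comp, ?_⟩
  rintro n r s k l K hn hr hs hk hl rfl
  -- The first index provides the word that transport consumes; the other `n` are convolved in
  -- advance and have letters at most `n`.
  obtain ⟨n, rfl⟩ : ∃ n', n = n' + 1 := ⟨n - 1, by omega⟩
  have hkpos : ∀ j, ∀ a ∈ List.ofFn (k j), 0 < a := by
    intro j a ha
    obtain ⟨i, rfl⟩ := List.mem_ofFn.1 ha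
    exact hk j i
  have hlpos : ∀ b ∈ (List.ofFn l).reverse, 0 < b := by
    intro b hb
    obtain ⟨i, rfl⟩ := List.mem_ofFn.1 (List.mem_reverse.1 hb)
    exact hl i
  have hwt {r : ℕ} (a : Fin r → ℕ) : (List.ofFn a).sum = weight a := List.sum_ofFn
  have hpos {r : ℕ} {a : Fin r → ℕ} (ha : IsIndex a) (hr : 0 < r) : 0 < weight a :=
    Finset.sum_pos (fun i _ => ha i) ⟨⟨0, hr⟩, Finset.mem_univ _⟩
  rw [evalAlgorithm_ofFn]
  set L := convAll (List.ofFn fun j : Fin n => List.ofFn (k j.succ)) with hL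
  set w := wordOf (List.ofFn (k 0)) with hw
  set l' := (List.ofFn l).reverse with hl'
  obtain ⟨c1, c2⟩ := convAll_ofFn_spec (fun j : Fin n => List.ofFn (k j.succ))
    fun j => hkpos j.succ
  obtain ⟨w1, w2, w3⟩ := wordOf_spec (hkpos 0)
  rw [← hL] at c1 c2
  rw [← hw] at w1 w2 w3
  have hwne : w ≠ [] := by
    rw [← List.length_pos_iff, w2, hwt]
    exact hpos (hk 0) (hr 0)
  have hpair : ∀ t ∈ L, (∀ u ∈ pairWords (t.1, l', t.2, w), Proper (n + 1)
      (∑ j, weight (k j) + weight l - 1) u.2) ∧ pairSum t.2 w l' ≠ ⊤ ∧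
      signedValue (pairWords (t.1, l', t.2, w)) = (-1) ^ t.1 * (pairSum t.2 w l').toReal := by
    intro t ht
    obtain ⟨t1, t2, t3⟩ := c2 t ht
    have htne : t.2 ≠ [] := by
      rw [← List.length_pos_iff, t2]
      refine Finset.sum_pos (fun j _ => ?_) ⟨⟨0, by omega⟩, Finset.mem_univ _⟩
      rw [hwt]
      exact hpos (hk _) (hr _)
    have hlen : t.2.length + w.length + l'.sum - 1 = ∑ j, weight (k j) + weight l - 1 := by
      rw [t2, w2, hl', List.sum_reverse, Fin.sum_univ_succ]
      simp only [hwt]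
      omega
    rw [← hlen]
    -- Transported letters can be 1, so the bound `n` for `v` must be at least 1: this uses that
    -- there are two indices or more.
    exact pairWords_spec (by omega) t1 htne w1 hwne t3 w3 hlpos
  have hcoef : (fun j => chainCoef (List.ofFn fun i => (k j i, (1 : ℝ))).reverse) =
      fun j => coef (wordOf (List.ofFn (k j))) := by
    funext j
    rw [coef_wordOf (hkpos j), List.map_reverse, List.map_ofFn]
    rfl
  have hZ := hasSum_signedCoef_connProd fun t ht => (hpair t ht).2
  set out := L.flatMap fun t => pairWords (t.1, l', t.2, w) with hout
  have hterm (M : ℕ) : 0 ≤ connProdFin (fun j => coef (wordOf (List.ofFn (k j)))) M :=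
    connProdFin_nonneg (fun j => coef_nonneg _) M
  have hsum : HasSum (connectedTerm k l) (signedValue out) := by
    have h1 := tsum_connectedTerm k l hl
    rw [hcoef] at h1
    simp_rw [← ENNReal.ofReal_mul (hterm _)] at h1
    have h2 : ∀ M : ℕ, connProdFin (fun j => coef (wordOf (List.ofFn (k j)))) M *
        (M * starCoef (List.ofFn l).reverse M) =
        connProd (signedCoef L) (coef w) M * (M * starCoef l' M) := by
      intro M
      rw [c1, connProd_comm]
      rfl
    simp_rw [h2] at h1
    have h0 (M : ℕ) : 0 ≤ connProd (signedCoef L) (coef w) M * (M * starCoef l' M) := by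
      rw [← h2]
      exact mul_nonneg (hterm M) (mul_nonneg (by positivity) (starCoef_nonneg _ _))
    rw [← ENNReal.ofReal_tsum_of_nonneg h0 hZ.summable, hZ.tsum_eq] at h1
    have h3 := hasSum_of_tsum_ofReal (connectedTerm_nonneg k l) h1 ENNReal.ofReal_ne_top
    rwa [ENNReal.toReal_ofReal (hZ.nonneg h0)] at h3
  have hK : ∑ j, weight (k j) + weight l - 1 + 1 = ∑ j, weight (k j) + weight l := by
    have := hpos hl hs
    omega
  have hproper : ∀ u ∈ out, Proper (n + 1) (∑ j, weight (k j) + weight l - 1) u.2 := by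
    intro u hu
    obtain ⟨t, ht, hu⟩ := List.mem_flatMap.1 hu
    exact (hpair t ht).1 u hu
  have hparam : ∀ t ∈ out.map outputEntry, IsMPLParam (n + 1) (∑ j, weight (k j) + weight l)
      (codeIndex t.2) (codeArg t.2) := by
    intro t ht
    obtain ⟨u, hu, rfl⟩ := List.mem_map.1 ht
    rw [← hK]
    exact (hproper u hu).isMPLParam
  have hval : connectedSum k l = ((out.map outputEntry).map
      (fun t => (t.1 : ℝ) * liSh (codeIndex t.2) (codeArg t.2))).sum := by
    rw [connectedSum, hsum.tsum_eq, signedValue, List.map_map]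
    congr 1
    refine List.map_congr_left fun u hu => ?_
    rw [← (hproper u hu).hasSum_liTerm.tsum_eq, ← outputEntry_sign]
    rfl
  refine ⟨hsum.summable, fun t ht => ⟨hparam t ht, ?_⟩, hval, ?_⟩
  · obtain ⟨u, hu, rfl⟩ := List.mem_map.1 ht
    exact (hproper u hu).hasSum_liTerm.summable
  · rw [hval]
    refine list_sum_mem fun x hx => ?_
    obtain ⟨t, ht, rfl⟩ := List.mem_map.1 hx
    rw [← zsmul_eq_mul]
    exact Submodule.smul_mem _ _ (Submodule.subset_span ⟨_, _, _, hparam t ht, rfl⟩)
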